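/- All tournaments are finite. For a tournament $T$ and a total ordering $<$ of $V(T)$, the backedge graph of $T$ with respect to $<$ is the graph on $V(T)$ in which, for $u<v$, the pair $uv$ is an edge if and only if $vu$ is an arc of $T$. The clique number $\overrightarrow{\omega}(T)$ is the minimum, over all total orderings of $V(T)$, of the clique number of the corresponding backedge graph. Write $X \Rightarrow Y$ if all arcs between the disjoint vertex sets $X$ and $Y$ go from $X$ to $Y$. The tournaments $A_n$ and $D_n$ ($n \ge 1$) are defined as follows. Both $A_1$ and $D_1$ have a single vertex. For $n \ge 2$, $D_n$ is the disjoint union of two copies $D', D''$ of $D_{n-1}$ and a vertex $v$, with $V(D') \Rightarrow V(D'') \Rightarrow \{v\} \Rightarrow V(D')$. For $n \ge 2$, $A_n$ is the disjoint union of $n-1$ copies $T_1,\dots,T_{n-1}$ of $A_{n-1}$ and $n$ further vertices $v_1,\dots,v_n$, where $v_j \Rightarrow v_i$ and $V(T_i) \Rightarrow V(T_j)$ whenever $i<j$, $v_i \Rightarrow V(T_j)$ whenever $i \le j$, and $V(T_j) \Rightarrow v_i$ whenever $i > j$. Corollary (confirming Conjecture 5.8 of Aboulker, Aubian, Charbit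 and Lopes). There are functions $f, \ell : \mathbb{Z} \to \mathbb{N}$ such that for every integer $k$, every tournament $T$ with $\overrightarrow{\omega}(T) \ge f(k)$ contains a subtournament $X$ with $|V(X)| \le \ell(k)$ and $\overrightarrow{\omega}(X) \ge k$. Moreover, $X$ can be chosen isomorphic to $A_n$ or to $D_n$, where $n = n(k) \ge 1$ depends only on $k$. -/

import Mathlib

/-- A tournament with vertex set `V`: a digraph without loops and without digons in which every two
distinct vertices are joined by an arc. `T.Adj u v` means that `uv` is an arc. -/
structure Tournament (V : Type*) extends Digraph V where
  asymm : ∀ u v : V, Adj u v → ¬ Adj v u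
  total : ∀ u v : V, u ≠ v → Adj u v ∨ Adj v u

namespace Tournament

/-- The backedge graph of `T` with respect to the total ordering `L` of the vertices: for `u < v`,
the pair `uv` is an edge if and only if `vu` is an arc of `T`. -/
def backedgeGraph {V : Type*} (T : Tournament V) (L : LinearOrder V) : SimpleGraph V where
  Adj u v := (L.lt u v ∧ T.Adj v u) ∨ (L.lt v u ∧ T.Adj u v)
  symm := ⟨fun _ _ h => Or.symm h⟩
  loopless := ⟨fun v h => by
    rcases h with h | h <;> exact T.asymm v v h.2 h.2⟩

/-- The clique number of a (finite) tournament: the minimum of the clique numbers of its backedge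
graphs, over all total orderings of the vertex set. -/
noncomputable def cliqueNumber {V : Type*} (T : Tournament V) : ℕ :=
  sInf {m : ℕ | ∃ L : LinearOrder V, (T.backedgeGraph L).cliqueNum = m}

/-- The subtournament of `T` induced by a set `X` of vertices. -/
def induce {V : Type*} (T : Tournament V) (X : Set V) : Tournament X where
  Adj u v := T.Adj u v
  asymm u v h := T.asymm u v h
  total u v h := T.total u v (fun e => h (Subtype.ext e))

/-- Two tournaments are isomorphic if some bijection of the vertex sets preserves and reflects
arcs. -/
def IsIsomorphic {V W : Type*} (T : Tournament V) (S : Tournament W) : Prop :=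
  Nonempty (T.Adj ≃r S.Adj)

/-- The empty tournament. -/
def empty : Tournament Empty where
  Adj _ _ := False
  asymm u := u.elim
  total u := u.elim

/-- The one-vertex tournament. -/
def single : Tournament Unit where
  Adj _ _ := False
  asymm _ _ h := h.elim
  total _ _ h := (h rfl).elim

/-- The arcs of `Δ(T₁, T₂, T₃)`: those of the three tournaments, together with
`V(T₁) ⇒ V(T₂) ⇒ V(T₃) ⇒ V(T₁)`. -/
def deltaAdj {V₁ V₂ V₃ : Type*} (T₁ : Tournament V₁) (T₂ : Tournament V₂) (T₃ : Tournament V₃) :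
    V₁ ⊕ V₂ ⊕ V₃ → V₁ ⊕ V₂ ⊕ V₃ → Prop
  | .inl x, .inl y => T₁.Adj x y
  | .inr (.inl x), .inr (.inl y) => T₂.Adj x y
  | .inr (.inr x), .inr (.inr y) => T₃.Adj x y
  | .inl _, .inr (.inl _) => True
  | .inr (.inl _), .inr (.inr _) => True
  | .inr (.inr _), .inl _ => True
  | .inr (.inl _), .inl _ => False
  | .inr (.inr _), .inr (.inl _) => False
  | .inl _, .inr (.inr _) => False

/-- The tournament `Δ(T₁, T₂, T₃)`. -/
def delta {V₁ V₂ V₃ : Type*} (T₁ : Tournament V₁) (T₂ : Tournament V₂) (T₃ : Tournament V₃) :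
    Tournament (V₁ ⊕ V₂ ⊕ V₃) where
  Adj := deltaAdj T₁ T₂ T₃
  asymm := by
    rintro (x | x | x) (y | y | y) <;> simp only [deltaAdj]
    · exact T₁.asymm x y
    all_goals try tauto
    · exact T₂.asymm x y
    · exact T₃.asymm x y
  total := by
    rintro (x | x | x) (y | y | y) h <;> simp only [deltaAdj]
    · exact T₁.total x y (by simpa using h)
    all_goals try tauto
    · exact T₂.total x y (by simpa using h)
    · exact T₃.total x y (by simpa using h)

/-- The vertex set of `D_n`. -/
def DVert : ℕ → Type
  | 0 => Empty
  | n + 1 => DVert n ⊕ DVert n ⊕ Unit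

/-- The tournament `D_n`: `D_n = Δ(D_{n-1}, D_{n-1}, D_1)`, with `D_1` a single vertex (which is the
case `n = 1` of the recursion when `D_0` is the empty tournament). -/
def D : (n : ℕ) → Tournament (DVert n)
  | 0 => empty
  | n + 1 => delta (D n) (D n) single

/-- The arcs of the tournament formed by vertices `v_0, …, v_n` and copies `T_0, …, T_{n-1}` of `T`:
`v_j ⇒ v_i` and `V(T_i) ⇒ V(T_j)` for `i < j`, `v_i ⇒ V(T_j)` for `i ≤ j`, and
`V(T_j) ⇒ v_i` for `i > j`. -/
def mountAdj {V : Type*} (n : ℕ) (T : Tournament V) :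
    Fin (n + 1) ⊕ Fin n × V → Fin (n + 1) ⊕ Fin n × V → Prop
  | .inl i, .inl j => j < i
  | .inr (i, x), .inr (j, y) => i < j ∨ (i = j ∧ T.Adj x y)
  | .inl i, .inr (j, _) => (i : ℕ) ≤ (j : ℕ)
  | .inr (j, _), .inl i => (j : ℕ) < (i : ℕ)

/-- The tournament with arcs `mountAdj n T`. -/
def mount {V : Type*} (n : ℕ) (T : Tournament V) : Tournament (Fin (n + 1) ⊕ Fin n × V) where
  Adj := mountAdj n T
  asymm := by
    rintro (i | ⟨i, x⟩) (j | ⟨j, y⟩) <;> simp only [mountAdj]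
    · omega
    · omega
    · omega
    · rintro (h | ⟨rfl, h⟩) (h' | ⟨h', h''⟩)
      · omega
      · omega
      · omega
      · exact T.asymm x y h h''
  total := by
    rintro (i | ⟨i, x⟩) (j | ⟨j, y⟩) h <;> simp only [mountAdj]
    · have : i ≠ j := by simpa using h
      omega
    · omega
    · omega
    · rcases lt_trichotomy i j with hij | rfl | hij
      · exact Or.inl (Or.inl hij)
      · have : x ≠ y := by simpa using h
        rcases T.total x y this with h' | h'
        · exact Or.inl (Or.inr ⟨rfl, h'⟩)
        · exact Or.inr (Or.inr ⟨rfl, h'⟩)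
      · exact Or.inr (Or.inl hij)

/-- The vertex set of `A_n`. -/
def AVert : ℕ → Type
  | 0 => Empty
  | n + 1 => Fin (n + 1) ⊕ Fin n × AVert n

/-- The tournament `A_n`: it is formed by `n` vertices and `n - 1` copies of `A_{n-1}`, joined as in
`mountAdj`. `A_1` is a single vertex, and by convention `A_0` is the empty tournament. -/
def A : (n : ℕ) → Tournament (AVert n)
  | 0 => empty
  | n + 1 => mount n (A n)

end Tournament

/-! ### Backedge cliques for rank functions, and clique bounds on vertex sets. -/

namespace Tournament
section CliqueBounds
open Finset
open scoped Classical
universe u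
variable {V : Type u}

/-! There are two halves. Every tournament of huge clique number contains `A m` or `D n`
(`exists_contains`), and `A n` and `D n` themselves have unbounded clique number
(`exists_backClique_of_contains_A`, `exists_backClique_of_contains_D`). It then suffices to take one
index large enough for both families.

The first half needs a local-to-global principle: large clique number is already visible on a subset
of bounded size (`exists_subset_not_cliqueBounded`). For an induction, clique bounds are refined to
weights: an ordering and a vertex colouring in which colour `a` has clique bound `lev a` weigh `∑ 3
^ lev a`. If every vertex of some colour is backedge-adjacent to one of two fixed vertices of that
colour, the class splits into two of lower level, and `2 * 3 ^ k < 3 ^ (k + 1)` makes the weight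
drop. By induction on the weight, a set all of whose small subsets have bounded weight has bounded
domination number (`exists_dominating_of_locallyGood`), and then bounded clique number
(`exists_cliqueBounded_of_locallyGood`).

Both the local-to-global theorem and the containment theorem use `cliqueBounded_of_zones`. Call `uv`
big if the vertices `x` with `u → x → v` induce a large clique number. If no pair is big in both
directions, bigness behaves like an order with a height function. Order the vertices by height: each
layer has no very big pair, so it is bounded, and a large backedge clique must contain a long
transitive sequence with big sets between its terms. For locally bounded weight such a sequence is
impossible. For containment, a pair big both ways yields `Δ(D n, D n, single)`; otherwise the slots
between consecutive terms of the sequence either yield this too, or contain copies of `A m` that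
complete the sequence to `A (m + 1)`.

The second half follows from a Ramsey property (`Contains.A_or_A`, `Contains.D_or_D`): an ordering
splits a copy into the vertices before and after a pivot, one part keeps a smaller copy, and a
suitable pivot extends its clique. -/

lemma irrefl (T : Tournament V) (v : V) : ¬ T.Adj v v := fun h => T.asymm v v h h

lemma ne_of_adj (T : Tournament V) {u v : V} (h : T.Adj u v) : u ≠ v := by
  rintro rfl; exact T.irrefl u h

lemma adj_of_not_adj (T : Tournament V) {u v : V} (hne : u ≠ v) (h : ¬ T.Adj u v) : T.Adj v u :=
  (T.total u v hne).resolve_left h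

/-- `Q` is a clique of the backedge graph of `T` for the vertex ordering given by the rank
function `r`. -/
def BackClique (T : Tournament V) (r : V → ℕ) (Q : Finset V) : Prop :=
  ∀ x ∈ Q, ∀ y ∈ Q, r x < r y → T.Adj y x

/-- The subtournament of `T` induced by `U` has clique number at most `m`. -/
def CliqueBounded (T : Tournament V) (U : Finset V) (m : ℕ) : Prop :=
  ∃ r : V → ℕ, Function.Injective r ∧ ∀ Q ⊆ U, T.BackClique r Q → Q.card ≤ m

variable {T : Tournament V}

lemma BackClique.insert {r : V → ℕ} {Q : Finset V} {e : V} (h : T.BackClique r Q)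
    (he : ∀ y ∈ Q, (r y < r e → T.Adj e y) ∧ (r e < r y → T.Adj y e)) :
    T.BackClique r (insert e Q) := by
  intro x hx y hy hxy
  rcases Finset.mem_insert.1 hx with rfl | hx'
  · rcases Finset.mem_insert.1 hy with rfl | hy'
    · exact absurd hxy (lt_irrefl _)
    · exact (he y hy').2 hxy
  · rcases Finset.mem_insert.1 hy with rfl | hy'
    · exact (he x hx').1 hxy
    · exact h x hx' y hy' hxy

lemma backClique_singleton (r : V → ℕ) (x : V) : T.BackClique r {x} := by
  intro a ha b hb hab
  rw [Finset.mem_singleton] at ha hb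
  subst ha hb
  exact absurd hab (lt_irrefl _)

lemma CliqueBounded.mono {U U' : Finset V} {m m' : ℕ} (h : T.CliqueBounded U m) (hU : U' ⊆ U)
    (hm : m ≤ m') : T.CliqueBounded U' m' := by
  obtain ⟨r, hr, h⟩ := h
  exact ⟨r, hr, fun Q hQ hc => (h Q (hQ.trans hU) hc).trans hm⟩

lemma exists_injective_rank (V : Type u) [Finite V] : ∃ r : V → ℕ, Function.Injective r :=
  have := Fintype.ofFinite V
  ⟨fun x => (Fintype.equivFin V x : ℕ), fun _ _ h => (Fintype.equivFin V).injective (Fin.ext h)⟩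

lemma cliqueBounded_card [Finite V] (U : Finset V) : T.CliqueBounded U U.card := by
  obtain ⟨r, hr⟩ := exists_injective_rank V
  exact ⟨r, hr, fun Q hQ _ => card_le_card hQ⟩

/-- Concatenation of vertex orderings. -/
lemma exists_layered_rank [Finite V] (h : V → ℕ) (rs : ℕ → V → ℕ)
    (hrs : ∀ j, Function.Injective (rs j)) :
    ∃ r : V → ℕ, Function.Injective r ∧ (∀ x y, h x < h y → r x < r y) ∧
      ∀ x y, h x = h y → (r x < r y ↔ rs (h x) x < rs (h x) y) := by
  have := Fintype.ofFinite V
  -- As `M` exceeds all ranks in use, `h x * M + rs (h x) x` orders lexicographically.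
  obtain ⟨M, hM⟩ : ∃ M, ∀ x, rs (h x) x < M :=
    ⟨univ.sup (fun x => rs (h x) x) + 1,
      fun x => Nat.lt_succ_of_le (Finset.le_sup (f := fun x => rs (h x) x) (mem_univ x))⟩
  have hlt : ∀ x y, h x < h y → h x * M + rs (h x) x < h y * M + rs (h y) y := by
    intro x y hxy
    have h1 := hM x
    have h2 : (h x + 1) * M ≤ h y * M := Nat.mul_le_mul_right _ hxy
    rw [add_mul] at h2
    omega
  refine ⟨fun x => h x * M + rs (h x) x, ?_, hlt, ?_⟩
  · intro x y hxy
    dsimp only at hxy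
    rcases lt_trichotomy (h x) (h y) with hl | he | hl
    · exact absurd hxy (hlt x y hl).ne
    · rw [he] at hxy
      exact hrs _ (Nat.add_left_cancel hxy)
    · exact absurd hxy (hlt y x hl).ne'
  · intro x y he
    dsimp only
    rw [← he]
    omega

/-- Put `U` first in its own order and everything else afterwards in the order for `U'`; a clique
then splits into its traces on `U` and outside `U`. -/
lemma CliqueBounded.union [Finite V] {U U' : Finset V} {m m' : ℕ} (h : T.CliqueBounded U m)
    (h' : T.CliqueBounded U' m') : T.CliqueBounded (U ∪ U') (m + m') := by
  obtain ⟨r, hr, h⟩ := h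
  obtain ⟨r', hr', h'⟩ := h'
  obtain ⟨s, hs, -, hs2⟩ := exists_layered_rank (fun x => if x ∈ U then 0 else 1)
    (fun j => if j = 0 then r else r') (fun j => by split_ifs <;> assumption)
  refine ⟨s, hs, fun Q hQ hc => ?_⟩
  rw [← card_filter_add_card_filter_not (s := Q) (fun x => x ∈ U)]
  refine add_le_add (h _ (fun x hx => (mem_filter.1 hx).2) ?_) (h' _ ?_ ?_)
  · intro x hx y hy hxy
    rw [mem_filter] at hx hy
    refine hc x hx.1 y hy.1 ((hs2 x y ?_).2 ?_) <;> simp [hx.2, hy.2, hxy]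
  · intro x hx
    rw [mem_filter] at hx
    exact (mem_union.1 (hQ hx.1)).resolve_left hx.2
  · intro x hx y hy hxy
    rw [mem_filter] at hx hy
    refine hc x hx.1 y hy.1 ((hs2 x y ?_).2 ?_) <;> simp [hx.2, hy.2, hxy]

lemma CliqueBounded.biUnion [Finite V] {ι : Type*} {s : Finset ι} {f : ι → Finset V} {m : ℕ}
    (h : ∀ i ∈ s, T.CliqueBounded (f i) m) : T.CliqueBounded (s.biUnion f) (s.card * m) := by
  induction s using Finset.induction_on with
  | empty => simpa using T.cliqueBounded_card (∅ : Finset V)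
  | insert i s hi ih =>
    rw [biUnion_insert, card_insert_of_notMem hi]
    refine ((h i (mem_insert_self _ _)).union
      (ih fun j hj => h j (mem_insert_of_mem hj))).mono subset_rfl (le_of_eq (by ring))

lemma CliqueBounded.cover [Finite V] {U A B : Finset V} {a b m : ℕ} (hA : T.CliqueBounded A a)
    (hB : T.CliqueBounded B b) (hU : U ⊆ A ∪ B) (hm : a + b ≤ m) : T.CliqueBounded U m :=
  (hA.union hB).mono hU hm

lemma nonempty_of_not_cliqueBounded [Finite V] {U : Finset V} {m : ℕ}
    (h : ¬ T.CliqueBounded U m) : U.Nonempty := by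
  rw [nonempty_iff_ne_empty]
  rintro rfl
  exact h ((T.cliqueBounded_card ∅).mono subset_rfl (by simp))

/-- The vertices of `U` that are out-neighbours of `u` and in-neighbours of `v`. -/
noncomputable def between (T : Tournament V) (U : Finset V) (u v : V) : Finset V :=
  U.filter fun x => T.Adj u x ∧ T.Adj x v

lemma mem_between {U : Finset V} {u v x : V} :
    x ∈ T.between U u v ↔ x ∈ U ∧ T.Adj u x ∧ T.Adj x v := by
  simp [between]

/-- The tournament with all arcs reversed. -/
def rev (T : Tournament V) : Tournament V where
  Adj u v := T.Adj v u
  asymm u v h := T.asymm v u h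
  total u v h := (T.total u v h).symm

lemma exists_reverse_rank [Finite V] {r : V → ℕ} (hr : Function.Injective r) :
    ∃ s : V → ℕ, Function.Injective s ∧ ∀ x y, s x < s y ↔ r y < r x := by
  have := Fintype.ofFinite V
  have hM : ∀ x, r x ≤ univ.sup r := fun x => Finset.le_sup (mem_univ x)
  refine ⟨fun x => univ.sup r - r x, fun x y h => hr ?_, fun x y => ?_⟩
  · have := hM x
    have := hM y
    dsimp only at h
    omega
  · have := hM x
    have := hM y
    dsimp only
    omega

/-- If all in-neighbourhoods within `Y` are bounded and `Y` has a small set of vertices such that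
every other vertex of `Y` has an out-neighbour in it, then `Y` is bounded. -/
lemma cliqueBounded_of_dominated [Finite V] {R : V → V → Prop} {Y F : Finset V} {n m : ℕ}
    (hF : F.card ≤ n) (hdom : ∀ y ∈ Y, y ∈ F ∨ ∃ e ∈ F, R e y)
    (hb : ∀ e ∈ F, T.CliqueBounded (Y.filter fun y => R e y) m) :
    T.CliqueBounded Y (n * (m + 1)) := by
  refine ((T.cliqueBounded_card F).cover (CliqueBounded.biUnion hb) (fun y hy => ?_)
    (m := F.card * (m + 1)) (by rw [mul_add, mul_one, add_comm])).mono subset_rfl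
    (Nat.mul_le_mul_right _ hF)
  rw [mem_union, mem_biUnion]
  rcases hdom y hy with h | ⟨e, he, h⟩
  · exact Or.inl h
  · exact Or.inr ⟨e, he, mem_filter.2 ⟨hy, h⟩⟩

end CliqueBounds
end Tournament

/-! ### Weighted colourings and the operations that lower the weight. -/

namespace Tournament
section Colourings
open Finset
open scoped Classical
universe u
variable {V : Type u} {T : Tournament V}

/-- A vertex ordering, a vertex colouring and a bound on clique sizes for every colour. -/
structure Colouring (V : Type u) where
  rank : V → ℕ
  col : V → ℕ
  lev : ℕ → ℕ

/-- The colour classes of `X` have backedge cliques of size at most the level of the colour, and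
the total weight `∑ 3 ^ level` of the colours is at most `w`. -/
def Fits (T : Tournament V) (d : Colouring V) (X : Finset V) (w : ℕ) : Prop :=
  Function.Injective d.rank ∧
    (∀ Q ⊆ X, T.BackClique d.rank Q → ∀ a, (∀ x ∈ Q, d.col x = a) → Q.card ≤ d.lev a) ∧
    ∑ a ∈ X.image d.col, 3 ^ d.lev a ≤ w

/-- `X` has weight at most `w` for some colouring. -/
def Good (T : Tournament V) (w : ℕ) (X : Finset V) : Prop := ∃ d, T.Fits d X w

/-- All subsets of `U` of size at most `ℓ` have weight at most `w`. -/
def LocallyGood (T : Tournament V) (ℓ w : ℕ) (U : Finset V) : Prop :=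
  ∀ X ⊆ U, X.card ≤ ℓ → T.Good w X

/-- Adjacency in the backedge graph for the ordering given by `r`. -/
def BackAdj (T : Tournament V) (r : V → ℕ) (y e : V) : Prop :=
  (r y < r e ∧ T.Adj e y) ∨ (r e < r y ∧ T.Adj y e)

lemma LocallyGood.mono {ℓ ℓ' w : ℕ} {U U' : Finset V} (h : T.LocallyGood ℓ w U) (hU : U' ⊆ U)
    (hl : ℓ' ≤ ℓ) : T.LocallyGood ℓ' w U' :=
  fun X hX hc => h X (hX.trans hU) (hc.trans hl)

lemma Fits.mono {d : Colouring V} {X Y : Finset V} {w : ℕ} (h : T.Fits d X w) (hY : Y ⊆ X) :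
    T.Fits d Y w :=
  ⟨h.1, fun Q hQ => h.2.1 Q (hQ.trans hY),
    (sum_le_sum_of_subset (image_subset_image hY)).trans h.2.2⟩

/-- Adding `e` to `Q` gives a larger clique of the same colour. -/
lemma Fits.card_lt {d : Colouring V} {X Q : Finset V} {w : ℕ} {e : V} (h : T.Fits d X w)
    (hQX : Q ⊆ X) (heX : e ∈ X) (hcol : ∀ x ∈ Q, d.col x = d.col e)
    (hadj : ∀ x ∈ Q, T.BackAdj d.rank x e) (hQ : T.BackClique d.rank Q) :
    Q.card < d.lev (d.col e) := by
  have he : e ∉ Q := by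
    intro he
    rcases hadj e he with h' | h' <;> exact absurd h'.1 (lt_irrefl _)
  have hcl : T.BackClique d.rank (insert e Q) := by
    refine hQ.insert fun y hy => ⟨fun hlt => ?_, fun hlt => ?_⟩
    · rcases hadj y hy with h' | h'
      · exact h'.2
      · exact absurd h'.1 hlt.asymm
    · rcases hadj y hy with h' | h'
      · exact absurd h'.1 hlt.asymm
      · exact h'.2
  have := h.2.1 _ (insert_subset heX hQX) hcl (d.col e) (by
    intro x hx
    rcases mem_insert.1 hx with rfl | hx
    · rfl
    · exact hcol x hx)
  rwa [card_insert_of_notMem he] at this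

lemma Fits.one_le {d : Colouring V} {X : Finset V} {w : ℕ} {e : V} (h : T.Fits d X w)
    (heX : e ∈ X) : 1 ≤ d.lev (d.col e) := by
  simpa using h.2.1 {e} (by simpa using heX) (backClique_singleton _ _) (d.col e) (by simp)

/-- Lowering a colour class: if the vertices of `Y` of one colour are all adjacent in the backedge
graph to one of two vertices of that colour, then the weight drops. -/
lemma Fits.good_of_backAdj {d : Colouring V} {X Y : Finset V} {w : ℕ} {e₁ e₂ : V}
    (h : T.Fits d X (w + 1)) (h₁ : e₁ ∈ X) (h₂ : e₂ ∈ X) (hc : d.col e₂ = d.col e₁)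
    (hY : Y ⊆ X) (hb : ∀ y ∈ Y, d.col y = d.col e₁ →
      T.BackAdj d.rank y e₁ ∨ T.BackAdj d.rank y e₂) : T.Good w Y := by
  obtain ⟨b, hbX⟩ := Infinite.exists_notMem_finset (X.image d.col)
  have hmem : d.col e₁ ∈ X.image d.col := mem_image_of_mem _ h₁
  have hba : b ≠ d.col e₁ := fun he => hbX (he ▸ hmem)
  have hbne : ∀ x ∈ X, d.col x ≠ b := fun x hx he => hbX (he ▸ mem_image_of_mem _ hx)
  set a₀ := d.col e₁ with ha₀
  -- Vertices of colour `a₀` not adjacent to `e₁` move to a fresh colour `b`; those are adjacent to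
  -- `e₂`. Each of the two classes has a common backedge neighbour of the old colour, so both levels
  -- fall by one.
  let c' : V → ℕ := fun y => if d.col y = a₀ ∧ ¬ T.BackAdj d.rank y e₁ then b else d.col y
  let l' : ℕ → ℕ := fun a => if a = a₀ ∨ a = b then d.lev a₀ - 1 else d.lev a
  have hl : 1 ≤ d.lev a₀ := h.one_le h₁
  refine ⟨⟨d.rank, c', l'⟩, h.1, fun Q hQ hcl a hQa => ?_, ?_⟩
  · have hQX := hQ.trans hY
    dsimp only at hcl hQa ⊢
    by_cases ha : a = a₀
    · have hx : ∀ x ∈ Q, d.col x = a₀ ∧ T.BackAdj d.rank x e₁ := by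
        intro x hx
        have := hQa x hx
        simp only [c'] at this
        split_ifs at this with hif
        · exact absurd (this.trans ha) hba
        · have hx0 := this.trans ha
          exact ⟨hx0, by_contra fun hn => hif ⟨hx0, hn⟩⟩
      have := h.card_lt hQX h₁ (fun x hxQ => (hx x hxQ).1) (fun x hxQ => (hx x hxQ).2) hcl
      rw [← ha₀] at this
      simp only [l', ha, true_or, if_true]
      omega
    · by_cases hab : a = b
      · have hx : ∀ x ∈ Q, d.col x = a₀ ∧ T.BackAdj d.rank x e₂ := by
          intro x hx
          have := hQa x hx
          simp only [c'] at this
          split_ifs at this with hif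
          · exact ⟨hif.1, (hb x (hQ hx) hif.1).resolve_left hif.2⟩
          · exact absurd (this.trans hab) (hbne x (hQX hx))
        have := h.card_lt hQX h₂ (fun x hxQ => (hx x hxQ).1.trans hc.symm)
          (fun x hxQ => (hx x hxQ).2) hcl
        rw [hc] at this
        simp only [l', hab, or_true, if_true]
        omega
      · have hx : ∀ x ∈ Q, d.col x = a := by
          intro x hx
          have := hQa x hx
          simp only [c'] at this
          split_ifs at this with hif
          · exact absurd this.symm hab
          · exact this
        simp only [l', ha, hab, or_self, if_false]
        exact h.2.1 Q hQX hcl a hx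
  · dsimp only
    have hsub : Y.image c' ⊆ insert b (X.image d.col) := by
      intro a ha
      obtain ⟨y, hy, rfl⟩ := mem_image.1 ha
      simp only [c']
      split_ifs
      · exact mem_insert_self _ _
      · exact mem_insert_of_mem (mem_image_of_mem _ (hY hy))
    have h1 := sum_le_sum_of_subset (f := fun a => 3 ^ l' a) hsub
    rw [sum_insert hbX, ← add_sum_erase _ _ hmem] at h1
    have h2 := h.2.2
    rw [← add_sum_erase _ _ hmem] at h2
    have h3 : ∑ a ∈ (X.image d.col).erase a₀, 3 ^ l' a
        = ∑ a ∈ (X.image d.col).erase a₀, 3 ^ d.lev a := by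
      refine sum_congr rfl fun a ha => ?_
      have hne := (mem_erase.1 ha).1
      have hnb : a ≠ b := fun he => hbX (he ▸ (mem_erase.1 ha).2)
      simp only [l', hne, hnb, or_self, if_false]
    have h4 : l' b = d.lev a₀ - 1 := by simp [l']
    have h5 : l' a₀ = d.lev a₀ - 1 := by simp [l']
    rw [h3, h4, h5] at h1
    -- The old class weighed `3 ^ (1 + k)`; its two replacements weigh `2 * 3 ^ k` together.
    obtain ⟨k, hk⟩ := Nat.exists_eq_add_of_le hl
    rw [hk] at h1 h2
    have h6 : 1 + k - 1 = k := by omega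
    rw [h6] at h1
    rw [pow_add, pow_one] at h2
    have h7 : 1 ≤ 3 ^ k := Nat.one_le_pow _ _ (by norm_num)
    omega

/-- If `u` precedes `v` and both have the same colour, then the weight of the set of vertices that
are out-neighbours of `v` and in-neighbours of `u` drops. -/
lemma Fits.good_of_between {d : Colouring V} {X Y : Finset V} {w : ℕ} {u v : V}
    (h : T.Fits d X (w + 1)) (hu : u ∈ X) (hv : v ∈ X) (hc : d.col u = d.col v)
    (hlt : d.rank u < d.rank v) (hY : Y ⊆ X) (hvY : ∀ y ∈ Y, T.Adj v y)
    (hYu : ∀ y ∈ Y, T.Adj y u) : T.Good w Y := by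
  refine h.good_of_backAdj hu hv hc.symm hY fun y hy _ => ?_
  -- As `u` precedes `v`, every `y` comes after `u` or before `v`, so `y → u` or `v → y` is a
  -- backedge.
  rcases lt_or_ge (d.rank u) (d.rank y) with hl | hl
  · exact Or.inl (Or.inr ⟨hl, hYu y hy⟩)
  · exact Or.inr (Or.inl ⟨hl.trans_lt hlt, hvY y hy⟩)

/-- Reversing arcs and ordering together preserves the backedge graph. This transfers domination
results from in-neighbours to out-neighbours. -/
lemma Good.rev [Finite V] {X : Finset V} {w : ℕ} (h : T.Good w X) : T.rev.Good w X := by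
  obtain ⟨d, hr, hc, hs⟩ := h
  obtain ⟨s, hs1, hs2⟩ := exists_reverse_rank hr
  refine ⟨⟨s, d.col, d.lev⟩, hs1, fun Q hQ hcl => hc Q hQ ?_, hs⟩
  intro x hx y hy hxy
  exact hcl y hy x hx ((hs2 y x).2 hxy)

lemma eq_empty_of_good_zero {X : Finset V} (h : T.Good 0 X) : X = ∅ := by
  obtain ⟨d, -, -, hs⟩ := h
  by_contra hne
  obtain ⟨x, hx⟩ := nonempty_iff_ne_empty.2 hne
  have h1 := single_le_sum (f := fun a => 3 ^ d.lev a) (fun _ _ => Nat.zero_le _)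
    (mem_image_of_mem d.col hx)
  have h2 : 1 ≤ 3 ^ d.lev (d.col x) := Nat.one_le_pow _ _ (by norm_num)
  omega

lemma good_empty [Finite V] (w : ℕ) : T.Good w ∅ := by
  obtain ⟨r, hr⟩ := exists_injective_rank V
  refine ⟨⟨r, fun _ => 0, fun _ => 0⟩, hr, fun Q hQ _ _ _ => ?_, by simp⟩
  rw [subset_empty.1 hQ]
  simp

lemma nonempty_of_not_good [Finite V] {w : ℕ} {X : Finset V} (h : ¬ T.Good w X) :
    X.Nonempty := by
  rw [nonempty_iff_ne_empty]
  rintro rfl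
  exact h (good_empty w)

/-- A single colour of level `q` suffices. -/
lemma CliqueBounded.good {X : Finset V} {q : ℕ} (h : T.CliqueBounded X q) :
    T.Good (3 ^ q) X := by
  obtain ⟨r, hr, h⟩ := h
  refine ⟨⟨r, fun _ => 0, fun _ => q⟩, hr, fun Q hQ hcl _ _ => h Q hQ hcl, ?_⟩
  calc ∑ a ∈ X.image (fun _ => 0), 3 ^ q ≤ ∑ a ∈ ({0} : Finset ℕ), 3 ^ q :=
        sum_le_sum_of_subset fun a ha => by
          obtain ⟨_, _, rfl⟩ := mem_image.1 ha
          simp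
    _ = 3 ^ q := by simp

end Colourings
end Tournament

/-! ### Dominating arbitrarily many cells with boundedly many vertices. -/

namespace Tournament
section Domination
open Finset
open scoped Classical
universe u
variable {V : Type u} {T : Tournament V}

/-- The vertices of `U` in the closed out-neighbourhoods of all vertices of `P` and in the
in-neighbourhoods of all vertices of `Q`. -/
noncomputable def cell (T : Tournament V) (U P Q : Finset V) : Finset V :=
  U.filter fun y => (∀ p ∈ P, p = y ∨ T.Adj p y) ∧ ∀ q ∈ Q, T.Adj y q

lemma mem_cell {U P Q : Finset V} {y : V} :
    y ∈ T.cell U P Q ↔ y ∈ U ∧ (∀ p ∈ P, p = y ∨ T.Adj p y) ∧ ∀ q ∈ Q, T.Adj y q := by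
  simp [cell]

lemma cell_anti {U P Q P' Q' : Finset V} (hP : P ⊆ P') (hQ : Q ⊆ Q') :
    T.cell U P' Q' ⊆ T.cell U P Q := by
  intro y hy
  rw [mem_cell] at hy ⊢
  exact ⟨hy.1, fun p hp => hy.2.1 p (hP hp), fun q hq => hy.2.2 q (hQ hq)⟩

/-- Every vertex of `U` belongs to `F` or has an in-neighbour in `F`. -/
def Dominates (T : Tournament V) (F U : Finset V) : Prop :=
  ∀ y ∈ U, y ∈ F ∨ ∃ e ∈ F, T.Adj e y

/-- The number of vertices that suffice to dominate a family of cells of total weight `μ`. -/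
def domBound : ℕ → ℕ
  | 0 => 0
  | μ + 1 => (μ + 1) + (μ + 1) * domBound μ

/-- Splitting one colour into two of smaller weight. -/
lemma sum_split_lt {s : Finset ℕ} {a b μ : ℕ} {f g : ℕ → ℕ} {t : Finset ℕ} (ha : a ∈ s)
    (hb : b ∉ s) (ht : t ⊆ insert b s) (hfa : 1 ≤ f a) (hga : g a + 1 ≤ f a)
    (hgb : g b + 1 ≤ f a) (hg : ∀ c ∈ s, c ≠ a → g c = f c)
    (hs : ∑ c ∈ s, 3 ^ f c ≤ μ + 1) : ∑ c ∈ t, 3 ^ g c ≤ μ := by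
  have h1 := sum_le_sum_of_subset (f := fun c => 3 ^ g c) ht
  rw [sum_insert hb, ← add_sum_erase _ _ ha] at h1
  rw [← add_sum_erase _ _ ha] at hs
  have h3 : ∑ c ∈ s.erase a, 3 ^ g c = ∑ c ∈ s.erase a, 3 ^ f c :=
    sum_congr rfl fun c hc => by rw [hg c (mem_erase.1 hc).2 (mem_erase.1 hc).1]
  rw [h3] at h1
  obtain ⟨k, hk⟩ := Nat.exists_eq_add_of_le hfa
  have h4 : 3 ^ g a ≤ 3 ^ k := Nat.pow_le_pow_right (by norm_num) (by omega)
  have h5 : 3 ^ g b ≤ 3 ^ k := Nat.pow_le_pow_right (by norm_num) (by omega)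
  have h7 : 1 ≤ 3 ^ k := Nat.one_le_pow _ _ (by norm_num)
  rw [hk, pow_add, pow_one] at hs
  omega

lemma card_le_sum_pow (s : Finset ℕ) (f : ℕ → ℕ) : s.card ≤ ∑ c ∈ s, 3 ^ f c := by
  rw [card_eq_sum_ones]
  exact sum_le_sum fun c _ => Nat.one_le_pow _ _ (by norm_num)

/-- A family of cells whose colour classes have bounded backedge cliques is dominated by a number
of vertices that does not depend on the number of cells. -/
lemma exists_dominating_of_cells {U X : Finset V} {rk : V → ℕ} (hrk : Function.Injective rk)
    {Xs : ℕ → Finset V} {adm : Finset V → Finset V → Prop}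
    (hadm : ∀ P Q P' Q', adm P Q → P ⊆ P' → Q ⊆ Q' → adm P' Q') {R : ℕ}
    (hmono : ∀ r, Xs r ⊆ Xs (r + 1)) (hX : ∀ r ≤ R, Xs r ⊆ X)
    (hdom : ∀ r < R, ∀ P ⊆ Xs r, ∀ Q ⊆ Xs r, adm P Q →
      ∃ E ⊆ Xs (r + 1), E ⊆ T.cell U P Q ∧ T.Dominates E (T.cell U P Q)) :
    ∀ μ r, r + μ ≤ R → ∀ (col : V → ℕ) (I : Finset (Finset V × Finset V)) (α β : ℕ → ℕ),
      (∀ i ∈ I, i.1 ⊆ Xs r ∧ i.2 ⊆ Xs r ∧ adm i.1 i.2) →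
      (∀ K ⊆ X, T.BackClique rk K → (∀ x ∈ K, ∃ i ∈ I, x ∈ T.cell U i.1 i.2) →
        ∀ a, (∀ x ∈ K, col x = a) → K.card ≤ α a) →
      (∀ i ∈ I, ∀ K ⊆ X, T.BackClique rk K → (∀ x ∈ K, x ∈ T.cell U i.1 i.2) →
        ∀ a, (∀ x ∈ K, col x = a) → K.card ≤ β a) →
      ∑ a ∈ X.image col, 3 ^ (α a + β a) ≤ μ →
      ∃ F ⊆ Xs (r + μ), F.card ≤ domBound μ ∧
        ∀ x ∈ X, (∃ i ∈ I, x ∈ T.cell U i.1 i.2) → x ∈ F ∨ ∃ e ∈ F, T.Adj e x := by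
  have hmono' : ∀ r k, Xs r ⊆ Xs (r + k) := by
    intro r k
    induction k with
    | zero => exact subset_rfl
    | succ k ih => exact ih.trans (hmono _)
  intro μ
  induction μ with
  | zero =>
    intro r _ col I α β _ _ _ hs
    refine ⟨∅, empty_subset _, by simp, fun x hx _ => ?_⟩
    have h1 := (card_le_sum_pow (X.image col) fun a => α a + β a).trans hs
    have h2 := card_pos.2 ⟨_, mem_image_of_mem col hx⟩
    omega
  | succ μ ih =>
    intro r hr col I α β hI hα hβ hs
    have hE : ∀ i, ∃ E : Finset V, i ∈ I →
        E ⊆ Xs (r + 1) ∧ E ⊆ T.cell U i.1 i.2 ∧ T.Dominates E (T.cell U i.1 i.2) := by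
      intro i
      by_cases hi : i ∈ I
      · obtain ⟨h1, h2, h3⟩ := hI i hi
        obtain ⟨E, hE⟩ := hdom r (by omega) _ h1 _ h2 h3
        exact ⟨E, fun _ => hE⟩
      · exact ⟨∅, fun h => absurd h hi⟩
    choose E hE using hE
    set EE := I.biUnion E with hEE
    have hEEX : EE ⊆ Xs (r + 1) := biUnion_subset.2 fun i hi => (hE i hi).1
    have hXX : Xs (r + 1) ⊆ X := hX _ (by omega)
    set C := X.image col with hC
    -- The union `EE` of dominating sets has uncontrolled size, so only the first vertex of each
    -- colour in it is kept.
    have ho : ∀ a, ∃ o : Finset V, o ⊆ EE ∧ o.card ≤ 1 ∧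
        ∀ x ∈ EE, col x = a → ∃ e ∈ o, col e = a ∧ rk e ≤ rk x := by
      intro a
      by_cases hne : (EE.filter fun x => col x = a).Nonempty
      · obtain ⟨e, he, hmin⟩ := exists_min_image _ rk hne
        rw [mem_filter] at he
        refine ⟨{e}, by simpa using he.1, by simp, fun x hx hxa => ⟨e, by simp, he.2, ?_⟩⟩
        exact hmin x (mem_filter.2 ⟨hx, hxa⟩)
      · refine ⟨∅, by simp, by simp, fun x hx hxa => ?_⟩
        exact absurd ⟨x, mem_filter.2 ⟨hx, hxa⟩⟩ hne
    choose o ho1 ho2 ho3 using ho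
    set F₀ := C.biUnion o with hF₀
    have hF₀E : F₀ ⊆ EE := biUnion_subset.2 fun a _ => ho1 a
    have hCμ : C.card ≤ μ + 1 := (card_le_sum_pow C _).trans hs
    -- A vertex left undominated by `F₀` sends arcs to all of `F₀` and is dominated by some `e ∈ E
    -- i`, so it lies in a refined cell. The refined cells are treated separately for each colour
    -- `a` of `e`.
    have key : ∀ a ∈ C, ∃ G ⊆ Xs (r + 1 + μ), G.card ≤ domBound μ ∧ ∀ x ∈ X,
        (∃ i ∈ I, ∃ e ∈ E i, col e = a ∧ x ∈ T.cell U (insert e i.1) (i.2 ∪ F₀)) →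
        x ∈ G ∨ ∃ e ∈ G, T.Adj e x := by
      intro a haC
      by_cases hne : ∃ x ∈ EE, col x = a
      swap
      · refine ⟨∅, by simp, by simp, ?_⟩
        rintro x - ⟨i, hi, e, he, hea, -⟩
        exact absurd ⟨e, mem_biUnion.2 ⟨i, hi, he⟩, hea⟩ hne
      obtain ⟨ea, hea0, hea⟩ : ∃ e ∈ o a, col e = a := by
        obtain ⟨x, hx, hxa⟩ := hne
        obtain ⟨e, he, h, -⟩ := ho3 a x hx hxa
        exact ⟨e, he, h⟩
      have hmin : ∀ x ∈ EE, col x = a → rk ea ≤ rk x := by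
        intro x hx hxa
        obtain ⟨e, he, -, h⟩ := ho3 a x hx hxa
        rwa [card_le_one.1 (ho2 a) ea hea0 e he]
      have heaF : ea ∈ F₀ := mem_biUnion.2 ⟨a, haC, hea0⟩
      have heaEE := hF₀E heaF
      have heaX := hXX (hEEX heaEE)
      obtain ⟨ia, hia, hia'⟩ := mem_biUnion.1 heaEE
      have heacell := (hE ia hia).2.1 hia'
      have hα1 : 1 ≤ α a := by
        simpa using hα {ea} (by simpa using heaX) (backClique_singleton _ _)
          (by simpa using ⟨ia.1, ia.2, hia, heacell⟩) a (by simpa using hea)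
      have hβ1 : 1 ≤ β a := by
        simpa using hβ ia hia {ea} (by simpa using heaX) (backClique_singleton _ _)
          (by simpa using heacell) a (by simpa using hea)
      obtain ⟨b, hbC⟩ := Infinite.exists_notMem_finset C
      have hba : b ≠ a := fun h => hbC (h ▸ haC)
      have hXb : ∀ x ∈ X, col x ≠ b := fun x hx h => hbC (h ▸ mem_image_of_mem _ hx)
      -- Colour `a` is cut at `ea`, the first vertex of that colour in `EE`. After `ea`, the arc to
      -- `ea` is a backedge and the bound `α` over all cells drops; before `ea`, the arc from `e` is
      -- a backedge and the bound `β` within one cell drops.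
      let col' : V → ℕ := fun x => if col x = a ∧ rk x < rk ea then b else col x
      let α' : ℕ → ℕ := fun c => if c = a then α a - 1 else if c = b then α a else α c
      let β' : ℕ → ℕ := fun c => if c = b then β a - 1 else β c
      let I' : Finset (Finset V × Finset V) := I.biUnion fun i =>
        ((E i).filter fun e => col e = a).image fun e => (insert e i.1, i.2 ∪ F₀)
      have hI' : ∀ j ∈ I', ∃ i ∈ I, ∃ e ∈ E i, col e = a ∧ j = (insert e i.1, i.2 ∪ F₀) := by
        intro j hj
        obtain ⟨i, hi, hj⟩ := mem_biUnion.1 hj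
        obtain ⟨e, he, rfl⟩ := mem_image.1 hj
        rw [mem_filter] at he
        exact ⟨i, hi, e, he.1, he.2, rfl⟩
      have hcella : ∀ x, (∃ j ∈ I', x ∈ T.cell U j.1 j.2) →
          (∃ i ∈ I, x ∈ T.cell U i.1 i.2) ∧ T.Adj x ea := by
        rintro x ⟨j, hj, hx⟩
        obtain ⟨i, hi, e, he, hea', rfl⟩ := hI' j hj
        refine ⟨⟨i, hi, cell_anti (subset_insert _ _) subset_union_left hx⟩, ?_⟩
        exact (mem_cell.1 hx).2.2 _ (mem_union_right _ heaF)
      have hcb : ∀ x ∈ X, col' x = b → col x = a ∧ rk x < rk ea := by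
        intro x hx h
        simp only [col'] at h
        split_ifs at h with hif
        · exact hif
        · exact absurd h (hXb x hx)
      have hcn : ∀ x c, c ≠ b → col' x = c → col x = c ∧ (c = a → rk ea ≤ rk x) := by
        intro x c hc h
        simp only [col'] at h
        split_ifs at h with hif
        · exact absurd h.symm hc
        · exact ⟨h, fun hca => not_lt.1 fun hlt => hif ⟨h.trans hca, hlt⟩⟩
      have hG : ∃ G ⊆ Xs (r + 1 + μ), G.card ≤ domBound μ ∧ ∀ x ∈ X,
          (∃ j ∈ I', x ∈ T.cell U j.1 j.2) → x ∈ G ∨ ∃ e ∈ G, T.Adj e x := by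
        refine ih (r + 1) (by omega) col' I' α' β' ?_ ?_ ?_ ?_
        · intro j hj
          obtain ⟨i, hi, e, he, hea', rfl⟩ := hI' j hj
          obtain ⟨h1, h2, h3⟩ := hI i hi
          exact ⟨insert_subset ((hE i hi).1 he) (h1.trans (hmono r)),
            union_subset (h2.trans (hmono r)) (hF₀E.trans hEEX),
            hadm _ _ _ _ h3 (subset_insert _ _) subset_union_left⟩
        · intro K hK hcl hKc c hKcol
          have hKI : ∀ x ∈ K, ∃ i ∈ I, x ∈ T.cell U i.1 i.2 := fun x hx => (hcella x (hKc x hx)).1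
          by_cases hcb' : c = b
          · subst hcb'
            have h : α' c = α a := by simp [α', hba]
            rw [h]
            exact hα K hK hcl hKI a fun x hx => (hcb x (hK hx) (hKcol x hx)).1
          have hcol : ∀ x ∈ K, col x = c := fun x hx => (hcn x c hcb' (hKcol x hx)).1
          by_cases hca : c = a
          · subst hca
            have h : α' c = α c - 1 := by simp [α']
            rw [h]
            have hgt : ∀ x ∈ K, rk ea < rk x := by
              intro x hx
              refine lt_of_le_of_ne ((hcn x c hcb' (hKcol x hx)).2 rfl) fun heq => ?_
              exact T.ne_of_adj (hcella x (hKc x hx)).2 (hrk heq).symm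
            have heaK : ea ∉ K := fun h => absurd (hgt ea h) (lt_irrefl _)
            -- `ea` may lie in a different cell from vertices of `K`, so only the bound over the
            -- union of cells improves.
            have := hα (insert ea K) (insert_subset heaX hK)
              (hcl.insert fun y hy => ⟨fun hlt => absurd hlt (hgt y hy).asymm,
                fun _ => (hcella y (hKc y hy)).2⟩)
              (by
                intro x hx
                rcases mem_insert.1 hx with rfl | hx
                · exact ⟨ia, hia, heacell⟩
                · exact hKI x hx) c
              (by
                intro x hx
                rcases mem_insert.1 hx with rfl | hx
                · exact hea
                · exact hcol x hx)
            rw [card_insert_of_notMem heaK] at this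
            omega
          · have h : α' c = α c := by simp [α', hca, hcb']
            rw [h]
            exact hα K hK hcl hKI c hcol
        · intro j hj K hK hcl hKc c hKcol
          obtain ⟨i, hi, e, he, hea', rfl⟩ := hI' j hj
          have hKI : ∀ x ∈ K, x ∈ T.cell U i.1 i.2 :=
            fun x hx => cell_anti (subset_insert _ _) subset_union_left (hKc x hx)
          by_cases hcb' : c = b
          · subst hcb'
            have h : β' c = β a - 1 := by simp [β']
            rw [h]
            have heEE : e ∈ EE := mem_biUnion.2 ⟨i, hi, he⟩
            have hlt : ∀ x ∈ K, rk x < rk e := fun x hx =>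
              (hcb x (hK hx) (hKcol x hx)).2.trans_le (hmin e heEE hea')
            have hadj : ∀ x ∈ K, T.Adj e x := by
              intro x hx
              rcases (mem_cell.1 (hKc x hx)).2.1 e (mem_insert_self _ _) with h | h
              · exact absurd (hlt x hx) (by rw [h]; exact lt_irrefl _)
              · exact h
            have heK : e ∉ K := fun h => absurd (hlt e h) (lt_irrefl _)
            -- Here `e` lies in the same old cell `i` as `K`, so the bound for a single cell
            -- improves.
            have := hβ i hi (insert e K) (insert_subset (hXX (hEEX heEE)) hK)
              (hcl.insert fun y hy => ⟨fun _ => hadj y hy,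
                fun hlt' => absurd hlt' (hlt y hy).asymm⟩)
              (by
                intro x hx
                rcases mem_insert.1 hx with rfl | hx
                · exact (hE i hi).2.1 he
                · exact hKI x hx) a
              (by
                intro x hx
                rcases mem_insert.1 hx with rfl | hx
                · exact hea'
                · exact (hcb x (hK hx) (hKcol x hx)).1)
            rw [card_insert_of_notMem heK] at this
            omega
          · have h : β' c = β c := by simp [β', hcb']
            rw [h]
            exact hβ i hi K hK hcl hKI c fun x hx => (hcn x c hcb' (hKcol x hx)).1
        · refine sum_split_lt (f := fun c => α c + β c) haC hbC ?_ ?_ ?_ ?_ ?_ hs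
          · intro c hc
            obtain ⟨x, hx, rfl⟩ := mem_image.1 hc
            simp only [col']
            split_ifs
            · exact mem_insert_self _ _
            · exact mem_insert_of_mem (mem_image_of_mem _ hx)
          · omega
          · simp only [α', β', if_true, hba.symm, if_false]
            omega
          · simp only [α', β', if_true, hba, if_false]
            omega
          · intro c hc hca
            have hcb' : c ≠ b := fun h => hbC (h ▸ hc)
            simp only [α', β', hca, hcb', if_false]
      obtain ⟨G, hG1, hG2, hG3⟩ := hG
      refine ⟨G, hG1, hG2, ?_⟩
      rintro x hx ⟨i, hi, e, he, hea', hxc⟩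
      refine hG3 x hx ⟨(insert e i.1, i.2 ∪ F₀), ?_, hxc⟩
      exact mem_biUnion.2 ⟨i, hi, mem_image.2 ⟨e, mem_filter.2 ⟨he, hea'⟩, rfl⟩⟩
    choose! G hG1 hG2 hG3 using key
    -- At most `μ + 1` colours occur, each contributing one vertex to `F₀` and one recursive set;
    -- this is the recursion of `domBound`.
    refine ⟨F₀ ∪ C.biUnion G, ?_, ?_, ?_⟩
    · have h : r + (μ + 1) = r + 1 + μ := by ring
      rw [h]
      exact union_subset ((hF₀E.trans hEEX).trans (hmono' _ _)) (biUnion_subset.2 hG1)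
    · refine (card_union_le _ _).trans ?_
      have h1 : F₀.card ≤ C.card * 1 := card_biUnion_le_card_mul _ _ _ fun a _ => ho2 a
      have h2 : (C.biUnion G).card ≤ C.card * domBound μ := card_biUnion_le_card_mul _ _ _ hG2
      have h3 : C.card * domBound μ ≤ (μ + 1) * domBound μ := Nat.mul_le_mul_right _ hCμ
      rw [domBound]
      omega
    · rintro x hx ⟨i, hi, hxi⟩
      by_contra hcon
      push Not at hcon
      obtain ⟨hcon1, hcon2⟩ := hcon
      have hxF : ∀ f ∈ F₀, T.Adj x f := by
        intro f hf
        refine T.adj_of_not_adj ?_ (hcon2 f (mem_union_left _ hf))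
        rintro rfl
        exact hcon1 (mem_union_left _ hf)
      obtain ⟨e, he, hex⟩ : ∃ e ∈ E i, e = x ∨ T.Adj e x := by
        rcases (hE i hi).2.2 x hxi with h | ⟨e, he, h⟩
        · exact ⟨x, h, Or.inl rfl⟩
        · exact ⟨e, he, Or.inr h⟩
      have heX : e ∈ X := hXX ((hE i hi).1 he)
      have hcol : col e ∈ C := mem_image_of_mem _ heX
      have hxc : x ∈ T.cell U (insert e i.1) (i.2 ∪ F₀) := by
        rw [mem_cell] at hxi ⊢
        refine ⟨hxi.1, fun p hp => ?_, fun q hq => ?_⟩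
        · rcases mem_insert.1 hp with rfl | hp
          · exact hex
          · exact hxi.2.1 p hp
        · rcases mem_union.1 hq with hq | hq
          · exact hxi.2.2 q hq
          · exact hxF q hq
      rcases hG3 _ hcol x hx ⟨i, hi, e, he, rfl, hxc⟩ with h | ⟨g, hg, h⟩
      · exact hcon1 (mem_union_right _ (mem_biUnion.2 ⟨_, hcol, h⟩))
      · exact hcon2 g (mem_union_right _ (mem_biUnion.2 ⟨_, hcol, hg⟩)) h

end Domination
end Tournament

/-! ### Locally bounded weight implies bounded domination number. -/

namespace Tournament
section BoundedDomination
open Finset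
open scoped Classical
universe u

lemma exists_card_min_dominating {V : Type u} (T : Tournament V) (U : Finset V) :
    ∃ D ⊆ U, T.Dominates D U ∧ ∀ D' ⊆ U, T.Dominates D' U → D.card ≤ D'.card := by
  have hne : (U.powerset.filter fun D => T.Dominates D U).Nonempty :=
    ⟨U, mem_filter.2 ⟨mem_powerset_self _, fun y hy => Or.inl hy⟩⟩
  obtain ⟨D, hD, hmin⟩ := exists_min_image _ card hne
  rw [mem_filter, mem_powerset] at hD
  exact ⟨D, hD.1, hD.2, fun D' h1 h2 => hmin D' (mem_filter.2 ⟨mem_powerset.2 h1, h2⟩)⟩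

/-- The cell of a vertex `s` and a set `A` of in-neighbours of `s` is of smaller weight. -/
lemma locallyGood_cell {V : Type u} {T : Tournament V} {U A : Finset V} {s : V} {ℓ ℓ₁ w : ℕ}
    (hU : T.LocallyGood ℓ (w + 1) U) (hℓ : 2 * ℓ₁ + 1 ≤ ℓ) (hA : A ⊆ U) (hAc : A.card ≤ ℓ₁)
    (hAg : ¬ T.Good w A) (hne : A.Nonempty) (hs : s ∈ U) (hAs : ∀ a ∈ A, T.Adj a s) :
    T.LocallyGood ℓ₁ w (T.cell U {s} A) := by
  intro Y hY hYc
  have hcell : ∀ y ∈ Y, y ∈ U ∧ T.Adj s y ∧ ∀ a ∈ A, T.Adj y a := by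
    intro y hy
    obtain ⟨h1, h2, h3⟩ := mem_cell.1 (hY hy)
    refine ⟨h1, (h2 s (mem_singleton_self s)).resolve_left ?_, h3⟩
    rintro rfl
    obtain ⟨a, ha⟩ := hne
    exact T.asymm _ _ (h3 a ha) (hAs a ha)
  obtain ⟨d, hd⟩ := hU (Y ∪ insert s A)
    (union_subset (fun y hy => (hcell y hy).1) (insert_subset hs hA)) (by
      have h1 := card_union_le Y (insert s A)
      have h2 := card_insert_le s A
      omega)
  have hsX : s ∈ Y ∪ insert s A := mem_union_right _ (mem_insert_self _ _)
  have hAX : A ⊆ Y ∪ insert s A := (subset_insert _ _).trans subset_union_right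
  -- A vertex `a` before `s` of the same colour makes the weight of `Y` drop, since `s → Y → a`.
  -- Otherwise all vertices of `A` of the colour of `s` come after `s` and point to it, so the
  -- weight of `A` would drop.
  by_cases hex : ∃ a ∈ A, d.col a = d.col s ∧ d.rank a < d.rank s
  · obtain ⟨a, ha, hc, hlt⟩ := hex
    exact hd.good_of_between (hAX ha) hsX hc hlt subset_union_left
      (fun y hy => (hcell y hy).2.1) fun y hy => (hcell y hy).2.2 a ha
  · refine absurd (hd.good_of_backAdj hsX hsX rfl hAX fun a ha hc => Or.inl (Or.inr ⟨?_, hAs a ha⟩))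
      hAg
    refine lt_of_le_of_ne (not_lt.1 fun hlt => hex ⟨a, ha, hc, hlt⟩) fun he => ?_
    exact T.ne_of_adj (hAs a ha) (hd.1 he).symm

/-- The sizes of the sets obtained by repeatedly adding dominating sets of all cells. -/
def closureSize (h n : ℕ) : ℕ → ℕ
  | 0 => n
  | r + 1 => closureSize h n r + 4 ^ closureSize h n r * h

/-- Repeatedly add the sets `dm` of all cells. -/
noncomputable def cellClosure {V : Type u} (T : Tournament V) (U : Finset V)
    (dm : Finset V → Finset V) (S : Finset V) : ℕ → Finset V
  | 0 => S
  | r + 1 => cellClosure T U dm S r ∪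
      ((cellClosure T U dm S r).powerset ×ˢ (cellClosure T U dm S r).powerset).biUnion
        fun p => dm (T.cell U p.1 p.2)

lemma card_cellClosure_le {V : Type u} {T : Tournament V} {U : Finset V}
    {dm : Finset V → Finset V} {S : Finset V} {h n : ℕ} (hdm : ∀ C, (dm C).card ≤ h)
    (hS : S.card ≤ n) (r : ℕ) : (T.cellClosure U dm S r).card ≤ closureSize h n r := by
  induction r with
  | zero => exact hS
  | succ r ih =>
    rw [cellClosure, closureSize]
    refine (card_union_le _ _).trans (add_le_add ih ?_)
    refine (card_biUnion_le_card_mul _ _ h fun p _ => hdm _).trans (Nat.mul_le_mul_right _ ?_)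
    rw [card_product, card_powerset, ← mul_pow]
    exact Nat.pow_le_pow_right (by norm_num) ih

/-- For the initial cells the bounds `α` and `β` are both the level, so the weight is at most
squared. -/
lemma sum_three_pow_add_le {s : Finset ℕ} {f : ℕ → ℕ} {w : ℕ} (h : ∑ a ∈ s, 3 ^ f a ≤ w) :
    ∑ a ∈ s, 3 ^ (f a + f a) ≤ w * w := by
  calc ∑ a ∈ s, 3 ^ (f a + f a) = ∑ a ∈ s, 3 ^ f a * 3 ^ f a := by simp only [pow_add]
    _ ≤ ∑ a ∈ s, 3 ^ f a * w := sum_le_sum fun a ha => Nat.mul_le_mul_left _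
        ((single_le_sum (f := fun a => 3 ^ f a) (fun _ _ => Nat.zero_le _) ha).trans h)
    _ = (∑ a ∈ s, 3 ^ f a) * w := by rw [sum_mul]
    _ ≤ w * w := Nat.mul_le_mul_right _ h

/-- Tournaments that are locally of bounded weight have bounded domination number. -/
theorem exists_dominating_of_locallyGood (w : ℕ) :
    ∃ ℓ h : ℕ, ∀ (V : Type u) [Finite V] (T : Tournament V) (U : Finset V),
      T.LocallyGood ℓ w U → ∃ F ⊆ U, F.card ≤ h ∧ T.Dominates F U := by
  induction w with
  | zero =>
    refine ⟨1, 0, fun V _ T U hU => ⟨∅, empty_subset _, le_rfl, fun y hy => ?_⟩⟩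
    have := eq_empty_of_good_zero (hU {y} (by simpa using hy) (by simp))
    simp at this
  | succ w ih =>
    obtain ⟨ℓ₁, h₁, ih⟩ := ih
    set R := (w + 1) * (w + 1) with hR
    -- `M` is large enough that trading `M` vertices of a minimum dominating set for `A` and
    -- `domBound R` further vertices would shrink it.
    set M := domBound R + ℓ₁ + 1 with hM
    set n := closureSize h₁ (M + ℓ₁) R with hn
    refine ⟨(2 * ℓ₁ + 1) + (n + 2 ^ n), M + h₁, fun V _ T U hU => ?_⟩
    obtain ⟨D, hDU, hD, hmin⟩ := T.exists_card_min_dominating U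
    by_cases hDM : D.card < M
    · exact ⟨D, hDU, by omega, hD⟩
    obtain ⟨W, hWD, hWc⟩ := exists_subset_card_eq (not_lt.1 hDM)
    have hWU := hWD.trans hDU
    -- A vertex not dominated by `W` points to all of `W`. If the set of such vertices has locally
    -- smaller weight, induction dominates it; otherwise it contains a small bad set `A`, complete
    -- to `W`.
    by_cases hloc : T.LocallyGood ℓ₁ w (U.filter fun y => ∀ s ∈ W, T.Adj y s)
    · obtain ⟨F, hFU, hFc, hF⟩ := ih V T _ hloc
      refine ⟨W ∪ F, union_subset hWU (hFU.trans (filter_subset _ _)),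
        (card_union_le _ _).trans (by omega), fun y hy => ?_⟩
      by_contra hcon
      push Not at hcon
      have hyW : ∀ s ∈ W, T.Adj y s := by
        intro s hs
        refine T.adj_of_not_adj ?_ (hcon.2 s (mem_union_left _ hs))
        rintro rfl
        exact hcon.1 (mem_union_left _ hs)
      rcases hF y (mem_filter.2 ⟨hy, hyW⟩) with h | ⟨e, he, h⟩
      · exact hcon.1 (mem_union_right _ h)
      · exact hcon.2 e (mem_union_right _ he) h
    simp only [LocallyGood, not_forall] at hloc
    obtain ⟨A, hA, hAc, hAg⟩ := hloc
    have hAne := nonempty_of_not_good hAg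
    have hAU : A ⊆ U := hA.trans (filter_subset _ _)
    have hAW : ∀ a ∈ A, ∀ s ∈ W, T.Adj a s := fun a ha => (mem_filter.1 (hA ha)).2
    have hdm : ∀ C : Finset V, ∃ E ⊆ C, E.card ≤ h₁ ∧
        ((∃ s ∈ W, C ⊆ T.cell U {s} A) → T.Dominates E C) := by
      intro C
      by_cases hC : ∃ s ∈ W, C ⊆ T.cell U {s} A
      · obtain ⟨s, hs, hC⟩ := hC
        obtain ⟨E, hE, hEc, hEd⟩ := ih V T C ((locallyGood_cell hU (Nat.le_add_right _ _) hAU hAc hAg hAne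
          (hWU hs) fun a ha => hAW a ha s hs).mono hC le_rfl)
        exact ⟨E, hE, hEc, fun _ => hEd⟩
      · exact ⟨∅, empty_subset _, by simp, fun h => absurd h hC⟩
    choose dm hdm1 hdm2 hdm3 using hdm
    -- If `F` dominated all cells of `{s}` and `A` with `s ∈ W`, then `(D \ W) ∪ (A ∪ F)` would
    -- dominate `U`: a vertex not dominated by `A` points to `A`, hence is outside `W`, and if only
    -- `W` dominates it then it is in a cell.
    have hnd : ∀ F : Finset V, F ⊆ U → F.card ≤ domBound R →
        ∃ x ∈ U, (∃ s ∈ W, x ∈ T.cell U {s} A) ∧ x ∉ F ∧ ∀ e ∈ F, ¬ T.Adj e x := by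
      intro F hFU hFc
      by_contra hcon
      push Not at hcon
      have hdom : T.Dominates ((D \ W) ∪ (A ∪ F)) U := by
        intro y hy
        by_contra hc
        push Not at hc
        obtain ⟨hc1, hc2⟩ := hc
        have hyA : ∀ a ∈ A, T.Adj y a := by
          intro a ha
          refine T.adj_of_not_adj ?_ (hc2 a (by simp [ha]))
          rintro rfl
          exact hc1 (by simp [ha])
        have hyW : y ∉ W := fun h => by
          obtain ⟨a, ha⟩ := hAne
          exact T.asymm _ _ (hyA a ha) (hAW a ha y h)
        obtain ⟨s, hs, hsy⟩ : ∃ s ∈ W, T.Adj s y := by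
          rcases hD y hy with h | ⟨e, he, h⟩
          · exact absurd (mem_union_left _ (mem_sdiff.2 ⟨h, hyW⟩)) hc1
          · by_cases heW : e ∈ W
            · exact ⟨e, heW, h⟩
            · exact absurd h (hc2 e (mem_union_left _ (mem_sdiff.2 ⟨he, heW⟩)))
        have hyc : y ∈ T.cell U {s} A :=
          mem_cell.2 ⟨hy, fun p hp => Or.inr (by rwa [mem_singleton.1 hp]), hyA⟩
        obtain ⟨e, he, hey⟩ := hcon y hy ⟨s, hs, hyc⟩ fun h => hc1 (by simp [h])
        exact hc2 e (by simp [he]) hey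
      have h1 := hmin _ (union_subset (sdiff_subset.trans hDU) (union_subset hAU hFU)) hdom
      have h2 := card_union_le (D \ W) (A ∪ F)
      have h3 := card_union_le A F
      have h4 := card_sdiff_add_card_eq_card hWD
      omega
    have hx : ∀ F : Finset V, ∃ x : Finset V, x.card ≤ 1 ∧ x ⊆ U ∧
        (F ⊆ U → F.card ≤ domBound R → ∃ y ∈ x, (∃ s ∈ W, y ∈ T.cell U {s} A) ∧ y ∉ F ∧
          ∀ e ∈ F, ¬ T.Adj e y) := by
      intro F
      by_cases hF : F ⊆ U ∧ F.card ≤ domBound R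
      · obtain ⟨y, hy, h⟩ := hnd F hF.1 hF.2
        exact ⟨{y}, by simp, by simpa using hy, fun _ _ => ⟨y, mem_singleton_self _, h⟩⟩
      · exact ⟨∅, by simp, by simp, fun h1 h2 => absurd ⟨h1, h2⟩ hF⟩
    choose xs hxs1 hxs2 hxs3 using hx
    set Xs := T.cellClosure U dm (W ∪ A) with hXs
    have hXsU : ∀ r, Xs r ⊆ U := by
      intro r
      induction r with
      | zero => exact union_subset hWU hAU
      | succ r ih =>
        exact union_subset ih (biUnion_subset.2 fun p _ =>
          (hdm1 _).trans (filter_subset _ _))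
    have hXsmono : ∀ r, Xs r ⊆ Xs (r + 1) := fun r => subset_union_left
    have hXsc : (Xs R).card ≤ n := card_cellClosure_le hdm2
      ((card_union_le _ _).trans (by omega)) R
    -- The dominating set `F` depends on a colouring of `X`, so `X` must contain in advance an
    -- undominated witness for every possible `F ⊆ Xs R`.
    set X := Xs R ∪ (Xs R).powerset.biUnion xs with hXdef
    have hXU : X ⊆ U := union_subset (hXsU R) (biUnion_subset.2 fun F _ => hxs2 F)
    have hXc : X.card ≤ n + 2 ^ n := by
      refine (card_union_le _ _).trans (add_le_add hXsc ?_)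
      refine (card_biUnion_le_card_mul _ _ 1 fun F _ => hxs1 F).trans ?_
      rw [card_powerset, mul_one]
      exact Nat.pow_le_pow_right (by norm_num) hXsc
    obtain ⟨d, hd⟩ := hU X hXU (hXc.trans (Nat.le_add_left _ _))
    have hXsR : ∀ r ≤ R, Xs r ⊆ X := fun r hr =>
      (monotone_nat_of_le_succ (f := Xs) hXsmono hr).trans subset_union_left
    obtain ⟨F, hFX, hFc, hF⟩ := exists_dominating_of_cells (T := T) (U := U) (X := X)
      (rk := d.rank) hd.1 (Xs := Xs) (adm := fun P Q => (∃ s ∈ W, s ∈ P) ∧ A ⊆ Q)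
      (fun P Q P' Q' h hP hQ => ⟨h.1.imp fun s hs => ⟨hs.1, hP hs.2⟩, h.2.trans hQ⟩)
      (R := R) hXsmono hXsR
      (by
        rintro r - P hP Q hQ ⟨⟨s, hs, hsP⟩, hAQ⟩
        refine ⟨dm (T.cell U P Q), fun y hy => ?_, hdm1 _, hdm3 _ ⟨s, hs, ?_⟩⟩
        · refine mem_union_right _ (mem_biUnion.2 ⟨(P, Q), ?_, hy⟩)
          exact mem_product.2 ⟨mem_powerset.2 hP, mem_powerset.2 hQ⟩
        · exact cell_anti (by simpa using hsP) hAQ)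
      R 0 (by omega) d.col (W.image fun s => ({s}, A)) d.lev d.lev
      (by
        intro i hi
        obtain ⟨s, hs, rfl⟩ := mem_image.1 hi
        exact ⟨singleton_subset_iff.2 (mem_union_left _ hs), subset_union_right, ⟨s, hs, by simp⟩,
          subset_rfl⟩)
      (fun K hK hcl _ a ha => hd.2.1 K hK hcl a ha)
      (fun _ _ K hK hcl _ a ha => hd.2.1 K hK hcl a ha)
      (sum_three_pow_add_le hd.2.2)
    rw [zero_add] at hFX
    obtain ⟨y, hy, ⟨s, hs, hyc⟩, hyF, hye⟩ := hxs3 F (hFX.trans (hXsU R)) hFc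
    have hyX : y ∈ X := mem_union_right _ (mem_biUnion.2 ⟨F, mem_powerset.2 hFX, hy⟩)
    rcases hF y hyX ⟨({s}, A), mem_image_of_mem _ hs, hyc⟩ with h | ⟨e, he, h⟩
    · exact absurd h hyF
    · exact absurd h (hye e he)

end BoundedDomination
end Tournament

/-! ### Big pairs, heights and layered orderings. -/

namespace Tournament
section Zones
open Finset
open scoped Classical
universe u
variable {V : Type u} {T : Tournament V}

/-- A finite transitive irreflexive relation has a height function without gaps. -/
lemma exists_height {α : Type*} [Finite α] {r : α → α → Prop}
    (htrans : ∀ x y z, r x y → r y z → r x z) (hirr : ∀ x, ¬ r x x) :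
    ∃ h : α → ℕ, (∀ x y, r x y → h x < h y) ∧ ∀ y, 0 < h y → ∃ x, r x y ∧ h x + 1 = h y := by
  have := Fintype.ofFinite α
  have : IsTrans α r := ⟨htrans⟩
  have : Std.Irrefl r := ⟨hirr⟩
  have hwf : WellFounded r := Finite.wellFounded_of_trans_of_irrefl r
  let F : ∀ y, (∀ x, r x y → ℕ) → ℕ := fun y ih =>
    (univ.filter fun x => r x y).attach.sup fun x => ih x.1 (mem_filter.1 x.2).2 + 1
  have hF : ∀ y, hwf.fix F y
      = (univ.filter fun x => r x y).attach.sup fun x => hwf.fix F x.1 + 1 := by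
    intro y
    rw [hwf.fix_eq]
  refine ⟨hwf.fix F, fun x y hxy => ?_, fun y hy => ?_⟩
  · rw [hF y]
    exact Nat.lt_of_succ_le (Finset.le_sup (f := fun x : {x // x ∈ univ.filter fun x => r x y} =>
      hwf.fix F x.1 + 1) (mem_attach _ ⟨x, mem_filter.2 ⟨mem_univ _, hxy⟩⟩))
  · have hne : (univ.filter fun x => r x y).attach.Nonempty := by
      rw [nonempty_iff_ne_empty]
      intro he
      rw [hF y, he] at hy
      exact absurd hy (lt_irrefl _)
    obtain ⟨x, -, hx⟩ := exists_mem_eq_sup _ hne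
      fun x : {x // x ∈ univ.filter fun x => r x y} => hwf.fix F x.1 + 1
    exact ⟨x.1, (mem_filter.1 x.2).2, by rw [hF y, hx]⟩

/-- Greedily take a lowest element and delete the three layers from its height upwards, at most `3 *
B` elements each time. -/
lemma exists_spread_list {α : Type*} {h : α → ℕ} {B : ℕ} (m : ℕ) (Q : Finset α)
    (hB : ∀ j, (Q.filter fun x => h x = j).card ≤ B) (hQ : 3 * B * m < Q.card) :
    ∃ l : List α, (∀ x ∈ l, x ∈ Q) ∧ l.length = m + 1 ∧
      l.Pairwise fun x y => h x + 3 ≤ h y := by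
  induction m generalizing Q with
  | zero =>
    obtain ⟨x, hx⟩ := card_pos.1 (Nat.zero_lt_of_lt hQ)
    exact ⟨[x], by simpa using hx, by simp, by simp⟩
  | succ m ih =>
    obtain ⟨x, hx, hmin⟩ := exists_min_image Q h (card_pos.1 (Nat.zero_lt_of_lt hQ))
    have hsub : Q ⊆ (Q.filter fun y => h x + 3 ≤ h y) ∪ ((Q.filter fun y => h y = h x) ∪
        ((Q.filter fun y => h y = h x + 1) ∪ (Q.filter fun y => h y = h x + 2))) := by
      intro y hy
      have := hmin y hy
      simp only [mem_union, mem_filter, hy, true_and]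
      omega
    have h1 := (card_le_card hsub).trans (card_union_le _ _)
    have h2 := card_union_le (Q.filter fun y => h y = h x)
      ((Q.filter fun y => h y = h x + 1) ∪ (Q.filter fun y => h y = h x + 2))
    have h3 := card_union_le (Q.filter fun y => h y = h x + 1) (Q.filter fun y => h y = h x + 2)
    have h4 := hB (h x)
    have h5 := hB (h x + 1)
    have h6 := hB (h x + 2)
    rw [mul_add, mul_one] at hQ
    obtain ⟨l, hl1, hl2, hl3⟩ := ih (Q.filter fun y => h x + 3 ≤ h y)
      (fun j => (card_le_card (filter_subset_filter _ (filter_subset _ _))).trans (hB j))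
      (by omega)
    refine ⟨x :: l, ?_, by simp [hl2], List.pairwise_cons.2
      ⟨fun y hy => (mem_filter.1 (hl1 y hy)).2, hl3⟩⟩
    intro y hy
    rcases List.mem_cons.1 hy with rfl | hy
    · exact hx
    · exact (mem_filter.1 (hl1 y hy)).1

/-- The set of vertices of `U` between `u` and `v` has clique number more than `m`. -/
def Big (T : Tournament V) (U : Finset V) (m : ℕ) (u v : V) : Prop :=
  ¬ T.CliqueBounded (T.between U u v) m

lemma Big.mono [Finite V] {U : Finset V} {m m' : ℕ} {u v : V} (h : T.Big U m u v)
    (hm : m' ≤ m) : T.Big U m' u v :=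
  fun hb => h (hb.mono subset_rfl hm)

lemma not_big_self [Finite V] (U : Finset V) (m : ℕ) (u : V) : ¬ T.Big U m u u := by
  intro h
  obtain ⟨x, hx⟩ := nonempty_of_not_cliqueBounded h
  obtain ⟨-, h1, h2⟩ := mem_between.1 hx
  exact T.asymm _ _ h1 h2

/-- A triangle inequality: each vertex other than `w` is an in- or out-neighbour of `w`. The extra
`1` in later constants pays for `w`. -/
lemma between_cover {U : Finset V} (u v w : V) :
    T.between U u v ⊆ T.between U u w ∪ (T.between U w v ∪ {w}) := by
  intro x hx
  simp only [mem_union, mem_between, mem_singleton] at hx ⊢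
  by_cases hxw : x = w
  · exact Or.inr (Or.inr hxw)
  · rcases T.total x w hxw with h | h
    · exact Or.inl ⟨hx.1, hx.2.1, h⟩
    · exact Or.inr (Or.inl ⟨hx.1, h, hx.2.2⟩)

lemma CliqueBounded.between_trans [Finite V] {U : Finset V} {u v w : V} {m m' : ℕ}
    (h : T.CliqueBounded (T.between U u w) m) (h' : T.CliqueBounded (T.between U w v) m') :
    T.CliqueBounded (T.between U u v) (m + (m' + 1)) :=
  h.cover (h'.union (T.cliqueBounded_card {w})) (between_cover u v w) le_rfl

/-- If no two vertices have large sets between them in both directions, and sets of vertices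
without large sets between them are bounded, then a tournament of large clique number contains
a long transitive sequence of vertices with large sets between them. -/
theorem cliqueBounded_of_zones [Finite V] {U : Finset V} {C C' B m : ℕ} (hCC : C ≤ C')
    (ha : ∀ u ∈ U, ∀ v ∈ U, T.Big U C u v → ¬ T.Big U C v u)
    (hcl : ∀ Y ⊆ U, (∀ u ∈ Y, ∀ v ∈ Y, ¬ T.Big U (2 * C' + 3 * C + 4) u v) →
      T.CliqueBounded Y B)
    (hm : ∀ l : List V, (∀ x ∈ l, x ∈ U) →
      l.Pairwise (fun x y => T.Adj y x ∧ T.Big U C' x y) → l.length ≤ m) :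
    T.CliqueBounded U (3 * B * m) := by
  -- Since `v w` is big, `w v` is not, so passing from `v` to `w` loses at most `C + 1`.
  have b1 : ∀ u v w k, v ∈ U → w ∈ U → T.Big U (k + (C + 1)) u v → T.Big U C v w →
      T.Big U k u w := fun u v w k hv hw h1 h2 hb =>
    h1 (hb.between_trans (not_not.1 (ha v hv w hw h2)))
  have b2 : ∀ u v w k, u ∈ U → v ∈ U → T.Big U C u v → T.Big U (k + (C + 1)) v w →
      T.Big U k u w := fun u v w k hu hv h1 h2 hb =>
    h2 (((not_not.1 (ha u hu v hv h1)).between_trans hb).mono subset_rfl (by omega))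
  set C₂ := C' + (C + 1) with hC₂
  -- This is `(2 * C₂ + 1) + (C + 1)`: after one loss of `C + 1` enough remains to split at a third
  -- vertex and keep more than `C₂` on one side.
  set C₁ := 2 * C' + 3 * C + 4 with hC₁
  let S : V → V → Prop := fun x y => x ∈ U ∧ y ∈ U ∧ T.Big U C₂ x y
  -- One very big step followed by any number of `C₂`-big steps. This is transitive without loss,
  -- and closed under appending a `C₂`-big step, whereas bigness itself is not transitive.
  let L : V → V → Prop := fun u v =>
    u ∈ U ∧ ∃ x ∈ U, T.Big U C₁ u x ∧ Relation.ReflTransGen S x v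
  have hSU : ∀ x ∈ U, ∀ v, Relation.ReflTransGen S x v → v ∈ U ∧ (x = v ∨ T.Big U C' x v) := by
    intro x hx v h
    induction h with
    | refl => exact ⟨hx, Or.inl rfl⟩
    | tail _ hs ih =>
      refine ⟨hs.2.1, Or.inr ?_⟩
      rcases ih.2 with rfl | h
      · exact hs.2.2.mono (by omega)
      · exact b2 _ _ _ _ hx ih.1 (h.mono hCC) hs.2.2
  have hLU : ∀ u v, L u v → v ∈ U ∧ T.Big U (2 * C₂ + 1) u v := by
    rintro u v ⟨hu, x, hx, h1, h2⟩
    refine ⟨(hSU x hx v h2).1, ?_⟩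
    rcases (hSU x hx v h2).2 with rfl | h
    · exact h1.mono (by omega)
    · exact b1 u x v _ hx (hSU x hx v h2).1 (h1.mono (by omega)) (h.mono hCC)
  have htrans : ∀ u v w, L u v → L v w → L u w := by
    rintro u v w ⟨hu, x, hx, h1, h2⟩ ⟨hv, y, hy, h3, h4⟩
    exact ⟨hu, x, hx, h1, (h2.tail ⟨hv, hy, h3.mono (by omega)⟩).trans h4⟩
  obtain ⟨h, hh1, hh2⟩ := exists_height htrans fun u hu => not_big_self _ _ _ (hLU u u hu).2
  have hfar : ∀ v ∈ U, ∀ w, h v + 3 ≤ h w → T.Big U C' v w := by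
    intro v hv w hvw
    obtain ⟨z, hz, hzw⟩ := hh2 w (by omega)
    obtain ⟨z', hz', hzz⟩ := hh2 z (by omega)
    obtain ⟨z'', hz'', hzz'⟩ := hh2 z' (by omega)
    -- Otherwise the chain from `z''` to `z'` would extend to `v`, although `v` is not higher than
    -- `z''`.
    have hnot : ¬ T.Big U C₂ z' v := by
      intro hb
      obtain ⟨hu, x, hx, h1, h2⟩ := hz''
      have := hh1 z'' v ⟨hu, x, hx, h1, h2.tail ⟨hz'.1, hv, hb⟩⟩
      omega
    have hbig : T.Big U C₂ v z := fun hb =>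
      (hLU _ _ hz').2 (((not_not.1 hnot).between_trans hb).mono subset_rfl (by omega))
    exact b1 v z w _ hz.1 (hLU z w hz).1 hbig ((hLU z w hz).2.mono (by omega))
  have hlayer : ∀ j, T.CliqueBounded (U.filter fun x => h x = j) B := by
    refine fun j => hcl _ (filter_subset _ _) fun u hu v hv hb => ?_
    rw [mem_filter] at hu hv
    have := hh1 u v ⟨hu.1, v, hv.1, hb, Relation.ReflTransGen.refl⟩
    omega
  choose rs hrs1 hrs2 using hlayer
  obtain ⟨r, hr1, hr2, hr3⟩ := exists_layered_rank h rs hrs1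
  refine ⟨r, hr1, fun Q hQ hc => ?_⟩
  by_contra hlt
  -- Each layer contributes at most `B` vertices to the clique `Q`, so more than `3 * B * m`
  -- vertices leave `m + 1` with heights pairwise at least three apart.
  obtain ⟨l, hl1, hl2, hl3⟩ := exists_spread_list (h := h) (B := B) m Q (by
    refine fun j => hrs2 j _ (filter_subset_filter _ hQ) fun x hx y hy hxy => ?_
    rw [mem_filter] at hx hy
    refine hc x hx.1 y hy.1 ((hr3 x y (hx.2.trans hy.2.symm)).2 ?_)
    rwa [hx.2]) (not_le.1 hlt)
  have := hm l (fun x hx => hQ (hl1 x hx)) (hl3.imp_of_mem fun hx hy hxy =>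
    ⟨hc _ (hl1 _ hx) _ (hl1 _ hy) (hr2 _ _ (by omega)), hfar _ (hQ (hl1 _ hx)) _ hxy⟩)
  omega

end Zones
end Tournament

/-! ### From locally bounded weight to bounded clique number. -/

namespace Tournament
section Local
open Finset
open scoped Classical
universe u
variable {V : Type u} {T : Tournament V}

/-- Each `s` between `u` and `v` splits the vertices from `v` to `u` into in- and out-neighbours,
one part large. A bad `Y` of vertices `s` of one type, with a bad `Z` in the large part of each,
forces every vertex of `Y` coloured like `u` (or like `v`) to be its backedge neighbour; then the
weight of `Y` drops. -/
lemma not_big_of_locallyGood [Finite V] {U : Finset V} {ℓ f w : ℕ}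
    (hbad : ∀ S ⊆ U, ¬ T.CliqueBounded S f → ∃ Z ⊆ S, Z.card ≤ ℓ ∧ ¬ T.Good w Z)
    (hU : T.LocallyGood (ℓ + (2 + ℓ * ℓ)) (w + 1) U) {u v : V} (hu : u ∈ U) (hv : v ∈ U)
    (huv : T.Big U (f + f) u v) : ¬ T.Big U (f + f) v u := by
  intro hvu
  have hbad' : ∀ S : Finset V, ∃ Z ⊆ S, Z.card ≤ ℓ ∧
      (S ⊆ U → ¬ T.CliqueBounded S f → ¬ T.Good w Z) := by
    intro S
    by_cases h : S ⊆ U ∧ ¬ T.CliqueBounded S f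
    · obtain ⟨Z, h1, h2, h3⟩ := hbad S h.1 h.2
      exact ⟨Z, h1, h2, fun _ _ => h3⟩
    · exact ⟨∅, empty_subset _, by simp, fun h1 h2 => absurd ⟨h1, h2⟩ h⟩
  choose Z hZ1 hZ2 hZ3 using hbad'
  have hfits : ∀ (Y : Finset V) (g : V → Finset V), Y ⊆ U → Y.card ≤ ℓ → (∀ s, g s ⊆ U) →
      ∃ d, T.Fits d (Y ∪ ({u, v} ∪ Y.biUnion fun s => Z (g s))) (w + 1) := by
    intro Y g hYU hYc hg
    refine hU _ (union_subset hYU (union_subset ?_ (biUnion_subset.2 fun s _ =>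
      (hZ1 _).trans (hg s)))) ?_
    · intro x hx
      rcases mem_insert.1 hx with rfl | hx
      · exact hu
      · rw [mem_singleton.1 hx]
        exact hv
    · refine (card_union_le _ _).trans (add_le_add hYc ((card_union_le _ _).trans
        (add_le_add card_le_two ?_)))
      exact (card_biUnion_le_card_mul _ _ ℓ fun s _ => hZ2 _).trans (Nat.mul_le_mul_right _ hYc)
  have hRU : ∀ p : V → Prop, (T.between U v u).filter p ⊆ U := fun p =>
    (filter_subset _ _).trans (filter_subset _ _)
  set S₁ := (T.between U u v).filter fun s =>
    ¬ T.CliqueBounded ((T.between U v u).filter fun x => T.Adj x s) f with hS₁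
  set S₂ := (T.between U u v).filter fun s =>
    ¬ T.CliqueBounded ((T.between U v u).filter fun x => T.Adj s x) f with hS₂
  have hS : T.between U u v ⊆ S₁ ∪ S₂ := by
    intro s hs
    rw [hS₁, hS₂, mem_union, mem_filter, mem_filter]
    by_contra hcon
    push Not at hcon
    refine hvu ((hcon.1 hs).cover (hcon.2 hs) (fun x hx => ?_) le_rfl)
    have hne : x ≠ s := by
      rintro rfl
      exact T.asymm _ _ (mem_between.1 hs).2.1 (mem_between.1 hx).2.2
    rw [mem_union, mem_filter, mem_filter]
    exact (T.total x s hne).imp (fun h => ⟨hx, h⟩) fun h => ⟨hx, h⟩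
  by_cases h₁ : T.CliqueBounded S₁ f
  · have h₂ : ¬ T.CliqueBounded S₂ f := fun h₂ => huv (h₁.cover h₂ hS le_rfl)
    have hS₂U : S₂ ⊆ U := (filter_subset _ _).trans (filter_subset _ _)
    obtain ⟨Y, hY, hYc, hYg⟩ := hbad S₂ hS₂U h₂
    obtain ⟨d, hd⟩ := hfits Y (fun s => (T.between U v u).filter fun x => T.Adj s x)
      (hY.trans hS₂U) hYc fun s => hRU _
    refine hYg (hd.good_of_backAdj (e₁ := u) (e₂ := u) (by simp) (by simp) rfl subset_union_left
      fun y hy hc => Or.inl (Or.inl ?_))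
    obtain ⟨hyb, hyZ⟩ := mem_filter.1 (hY hy)
    have huy := (mem_between.1 hyb).2.1
    refine ⟨lt_of_not_ge fun hle => ?_, huy⟩
    have hlt := lt_of_le_of_ne hle fun he => T.ne_of_adj huy (hd.1 he)
    have hmem := fun (x : V) (hx : x ∈ Z ((T.between U v u).filter fun x => T.Adj y x)) =>
      mem_filter.1 (hZ1 _ hx)
    exact hZ3 _ (hRU _) hyZ (hd.good_of_between (by simp) (mem_union_left _ hy) hc.symm hlt
      ((subset_biUnion_of_mem (fun s => Z ((T.between U v u).filter fun x => T.Adj s x)) hy).trans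
        (subset_union_right.trans subset_union_right))
      (fun x hx => (hmem x hx).2) fun x hx => (mem_between.1 (hmem x hx).1).2.2)
  · have hS₁U : S₁ ⊆ U := (filter_subset _ _).trans (filter_subset _ _)
    obtain ⟨Y, hY, hYc, hYg⟩ := hbad S₁ hS₁U h₁
    obtain ⟨d, hd⟩ := hfits Y (fun s => (T.between U v u).filter fun x => T.Adj x s)
      (hY.trans hS₁U) hYc fun s => hRU _
    refine hYg (hd.good_of_backAdj (e₁ := v) (e₂ := v) (by simp) (by simp) rfl subset_union_left
      fun y hy hc => Or.inl (Or.inr ?_))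
    obtain ⟨hyb, hyZ⟩ := mem_filter.1 (hY hy)
    have hyv := (mem_between.1 hyb).2.2
    refine ⟨lt_of_not_ge fun hle => ?_, hyv⟩
    have hlt := lt_of_le_of_ne hle fun he => T.ne_of_adj hyv (hd.1 he)
    have hmem := fun (x : V) (hx : x ∈ Z ((T.between U v u).filter fun x => T.Adj x y)) =>
      mem_filter.1 (hZ1 _ hx)
    exact hZ3 _ (hRU _) hyZ (hd.good_of_between (mem_union_left _ hy) (by simp) hc hlt
      ((subset_biUnion_of_mem (fun s => Z ((T.between U v u).filter fun x => T.Adj x s)) hy).trans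
        (subset_union_right.trans subset_union_right))
      (fun x hx => (mem_between.1 (hmem x hx).1).2.1) fun x hx => (hmem x hx).2)

/-- A bad set between each two terms forces terms of equal colour to be ranked in list order, so
every colour class is a backedge clique. The number of terms is then at most the sum of the levels,
hence at most the weight. -/
lemma length_le_of_locallyGood [Finite V] {U : Finset V} {ℓ f w : ℕ}
    (hbad : ∀ S ⊆ U, ¬ T.CliqueBounded S f → ∃ Z ⊆ S, Z.card ≤ ℓ ∧ ¬ T.Good w Z)
    (hU : T.LocallyGood ((w + 2) + (w + 2) * (w + 2) * ℓ) (w + 1) U) {l : List V}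
    (hlU : ∀ x ∈ l, x ∈ U) (hl : l.Pairwise fun x y => T.Adj y x ∧ T.Big U f x y) :
    l.length ≤ w + 1 := by
  by_contra hlen
  replace hl := hl.sublist (List.take_sublist (w + 2) l)
  set L := (l.take (w + 2)).toFinset with hL
  have hLU : L ⊆ U := fun x hx => hlU x (List.mem_of_mem_take (List.mem_toFinset.1 hx))
  have hLc : L.card = w + 2 := by
    rw [hL, List.toFinset_card_of_nodup (hl.imp fun h => (T.ne_of_adj h.1).symm),
      List.length_take]
    omega
  have hbad' : ∀ p : V × V, ∃ Z ⊆ T.between U p.1 p.2, Z.card ≤ ℓ ∧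
      (T.Big U f p.1 p.2 → ¬ T.Good w Z) := by
    intro p
    by_cases h : T.Big U f p.1 p.2
    · obtain ⟨Z, h1, h2, h3⟩ := hbad _ (filter_subset _ _) h
      exact ⟨Z, h1, h2, fun _ => h3⟩
    · exact ⟨∅, empty_subset _, by simp, fun h' => absurd h' h⟩
  choose Z hZ1 hZ2 hZ3 using hbad'
  obtain ⟨d, hd⟩ := hU (L ∪ (L ×ˢ L).biUnion Z)
    (union_subset hLU (biUnion_subset.2 fun p _ => (hZ1 p).trans (filter_subset _ _))) (by
      refine (card_union_le _ _).trans (add_le_add hLc.le ?_)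
      refine (card_biUnion_le_card_mul _ _ ℓ fun p _ => hZ2 p).trans ?_
      rw [card_product, hLc])
  have hpair : ∀ x ∈ L, ∀ y ∈ L, T.Adj y x → T.Big U f x y → d.col x = d.col y →
      d.rank x < d.rank y := by
    intro x hx y hy hyx hb hc
    refine lt_of_not_ge fun hle => ?_
    have hlt := lt_of_le_of_ne hle fun he => T.ne_of_adj hyx (hd.1 he)
    have hmem := fun (z : V) (hz : z ∈ Z (x, y)) => (mem_between.1 (hZ1 (x, y) hz)).2
    exact hZ3 (x, y) hb (hd.good_of_between (mem_union_left _ hy) (mem_union_left _ hx) hc.symm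
      hlt ((subset_biUnion_of_mem Z (mem_product.2 ⟨hx, hy⟩)).trans subset_union_right)
      (fun z hz => (hmem z hz).1) fun z hz => (hmem z hz).2)
  have hsymm : ∀ x ∈ L, ∀ y ∈ L, x ≠ y → (T.Adj y x ∧ T.Big U f x y) ∨
      (T.Adj x y ∧ T.Big U f y x) := by
    intro x hx y hy hne
    have : Std.Symm fun x y => (T.Adj y x ∧ T.Big U f x y) ∨ (T.Adj x y ∧ T.Big U f y x) :=
      ⟨fun _ _ => Or.symm⟩
    exact (hl.imp (S := fun x y => (T.Adj y x ∧ T.Big U f x y) ∨ (T.Adj x y ∧ T.Big U f y x))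
      Or.inl).forall (List.mem_toFinset.1 hx) (List.mem_toFinset.1 hy) hne
  have hcl : ∀ a, (L.filter fun x => d.col x = a).card ≤ d.lev a := by
    refine fun a => hd.2.1 _ ((filter_subset _ _).trans subset_union_left) ?_ a fun x hx =>
      (mem_filter.1 hx).2
    intro x hx y hy hlt
    rw [mem_filter] at hx hy
    rcases hsymm x hx.1 y hy.1 (fun h => hlt.ne (h ▸ rfl)) with h | h
    · exact h.1
    · exact absurd hlt (hpair y hy.1 x hx.1 h.1 h.2 (hy.2.trans hx.2.symm)).asymm
  have h1 : L.card ≤ ∑ a ∈ L.image d.col, 3 ^ d.lev a := by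
    rw [card_eq_sum_card_image d.col L]
    exact sum_le_sum fun a _ => (hcl a).trans (Nat.lt_pow_self (by norm_num)).le
  have h2 := (hd.mono (Y := L) subset_union_left).2.2
  omega

/-- A set of vertices in which all sets between two vertices are bounded, and all of whose small
subsets have bounded weight, is bounded. -/
lemma cliqueBounded_of_between [Finite V] {U Y : Finset V} {ℓ h w C : ℕ}
    (hdom : ∀ (T : Tournament V) (U : Finset V),
      T.LocallyGood ℓ w U → ∃ F ⊆ U, F.card ≤ h ∧ T.Dominates F U)
    (hU : T.LocallyGood ℓ w U) (hYU : Y ⊆ U)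
    (hY : ∀ u ∈ Y, ∀ v ∈ Y, ¬ T.Big U C u v) :
    T.CliqueBounded Y (1 + (h * (C + 1) + h * (C + 1))) := by
  rcases Y.eq_empty_or_nonempty with rfl | ⟨v, hv⟩
  · exact (T.cliqueBounded_card ∅).mono subset_rfl (by simp)
  have hsub : ∀ p : V → Prop, Y.filter p ⊆ U := fun p => (filter_subset _ _).trans hYU
  -- Out-neighbours of `v` need a set `F` reached from each of them; each is then in `F` or between
  -- `v` and a vertex of `F`.
  obtain ⟨F, hF, hFc, hFd⟩ := hdom T.rev (Y.filter fun y => T.Adj v y) fun X hX hc =>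
    (hU X (hX.trans (hsub _)) hc).rev
  obtain ⟨F', hF', hFc', hFd'⟩ := hdom T (Y.filter fun y => T.Adj y v) (hU.mono (hsub _) le_rfl)
  have h1 := T.cliqueBounded_of_dominated (R := fun e y => T.Adj y e) (m := C) hFc hFd
    fun e he => (not_not.1 (hY v hv e (mem_filter.1 (hF he)).1)).mono (fun y hy => by
      simp only [mem_filter] at hy
      exact mem_between.2 ⟨hYU hy.1.1, hy.1.2, hy.2⟩) le_rfl
  have h2 := T.cliqueBounded_of_dominated (R := fun e y => T.Adj e y) (m := C) hFc' hFd'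
    fun e he => (not_not.1 (hY e (mem_filter.1 (hF' he)).1 v hv)).mono (fun y hy => by
      simp only [mem_filter] at hy
      exact mem_between.2 ⟨hYU hy.1.1, hy.2, hy.1.2⟩) le_rfl
  refine (T.cliqueBounded_card {v}).cover (h1.union h2) (fun y hy => ?_) le_rfl
  simp only [mem_union, mem_singleton, mem_filter]
  by_cases hyv : y = v
  · exact Or.inl hyv
  · exact Or.inr ((T.total v y (Ne.symm hyv)).imp (fun h => ⟨hy, h⟩) fun h => ⟨hy, h⟩)

/-- Tournaments that are locally of bounded weight have bounded clique number. -/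
theorem exists_cliqueBounded_of_locallyGood (w : ℕ) :
    ∃ ℓ f : ℕ, ∀ (V : Type u) [Finite V] (T : Tournament V) (U : Finset V),
      T.LocallyGood ℓ w U → T.CliqueBounded U f := by
  induction w with
  | zero =>
    refine ⟨1, 0, fun V _ T U hU => ?_⟩
    have : U = ∅ := eq_empty_of_forall_notMem fun y hy => by
      have := eq_empty_of_good_zero (hU {y} (by simpa using hy) (by simp))
      simp at this
    exact (T.cliqueBounded_card U).mono subset_rfl (by simp [this])
  | succ w ih =>
    obtain ⟨ℓ, f, ih⟩ := ih
    obtain ⟨ℓ', h, hdom⟩ := exists_dominating_of_locallyGood.{u} (w + 1)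
    refine ⟨(ℓ + (2 + ℓ * ℓ)) + ((w + 2) + (w + 2) * (w + 2) * ℓ) + ℓ',
      3 * (1 + (h * (2 * (f + f) + 3 * (f + f) + 4 + 1) +
        h * (2 * (f + f) + 3 * (f + f) + 4 + 1))) * (w + 1),
      fun V _ T U hU => ?_⟩
    have hbad : ∀ S ⊆ U, ¬ T.CliqueBounded S f → ∃ Z ⊆ S, Z.card ≤ ℓ ∧ ¬ T.Good w Z := by
      intro S _ hS
      by_contra hcon
      push Not at hcon
      exact hS (ih V T S hcon)
    exact T.cliqueBounded_of_zones (C := f + f) (C' := f + f) le_rfl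
      (fun u hu v hv => not_big_of_locallyGood hbad (hU.mono subset_rfl (by omega)) hu hv)
      (fun Y hY hb => cliqueBounded_of_between (hdom V) (hU.mono subset_rfl (by omega)) hY hb)
      (fun l hl hp => length_le_of_locallyGood hbad (hU.mono subset_rfl (by omega)) hl
        (hp.imp fun hxy => ⟨hxy.1, hxy.2.mono (by omega)⟩))

/-- A set of large clique number has a subset of bounded size and large clique number. -/
theorem exists_subset_not_cliqueBounded (q : ℕ) :
    ∃ ℓ f : ℕ, ∀ (V : Type u) [Finite V] (T : Tournament V) (U : Finset V),
      ¬ T.CliqueBounded U f → ∃ J ⊆ U, J.card ≤ ℓ ∧ ¬ T.CliqueBounded J q := by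
  obtain ⟨ℓ, f, h⟩ := exists_cliqueBounded_of_locallyGood.{u} (3 ^ q)
  refine ⟨ℓ, f, fun V _ T U hU => ?_⟩
  by_contra hcon
  push Not at hcon
  exact hU (h V T U fun X hX hc => (hcon X hX hc).good)

end Local
end Tournament

/-! ### Finding a copy of `A m` or `D n`. -/

namespace Tournament
section Containment
open Finset
open scoped Classical
universe u
variable {V : Type u} {T : Tournament V}

/-- The subtournament of `T` induced by `U` contains a copy of `S`. -/
def Contains {W : Type*} (T : Tournament V) (U : Finset V) (S : Tournament W) : Prop :=
  ∃ φ : W → V, (∀ x, φ x ∈ U) ∧ ∀ x y, S.Adj x y → T.Adj (φ x) (φ y)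

/-- All arcs between `X` and `Y` go from `X` to `Y`. -/
def Complete (T : Tournament V) (X Y : Finset V) : Prop := ∀ x ∈ X, ∀ y ∈ Y, T.Adj x y

lemma Contains.mono {W : Type*} {S : Tournament W} {U U' : Finset V} (h : T.Contains U S)
    (hU : U ⊆ U') : T.Contains U' S :=
  h.imp fun _ hφ => ⟨fun x => hU (hφ.1 x), hφ.2⟩

lemma contains_empty (U : Finset V) : T.Contains U empty :=
  ⟨Empty.elim, fun x => x.elim, fun x => x.elim⟩

lemma contains_delta_single {W W' : Type*} {S : Tournament W} {S' : Tournament W'}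
    {U X Y : Finset V} {v : V} (hX : X ⊆ U) (hY : Y ⊆ U) (hv : v ∈ U) (hS : T.Contains X S)
    (hS' : T.Contains Y S') (hXY : T.Complete X Y) (hYv : ∀ y ∈ Y, T.Adj y v)
    (hvX : ∀ x ∈ X, T.Adj v x) : T.Contains U (delta S S' single) := by
  obtain ⟨φ, hφ1, hφ2⟩ := hS
  obtain ⟨ψ, hψ1, hψ2⟩ := hS'
  refine ⟨Sum.elim φ (Sum.elim ψ fun _ => v), ?_, ?_⟩
  · rintro (x | x | x)
    · exact hX (hφ1 x)
    · exact hY (hψ1 x)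
    · exact hv
  · rintro (x | x | x) (y | y | y) h
    · exact hφ2 x y h
    · exact hXY _ (hφ1 x) _ (hψ1 y)
    · exact h.elim
    · exact h.elim
    · exact hψ2 x y h
    · exact hYv _ (hψ1 x)
    · exact hvX _ (hφ1 y)
    · exact h.elim
    · exact h.elim

lemma Contains.exists_delta_single {W W' : Type*} {S : Tournament W} {S' : Tournament W'}
    {U : Finset V} (h : T.Contains U (delta S S' single)) :
    ∃ X ⊆ U, ∃ Y ⊆ U, ∃ v ∈ U, T.Contains X S ∧ T.Contains Y S' ∧ T.Complete X Y ∧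
      (∀ y ∈ Y, T.Adj y v) ∧ ∀ x ∈ X, T.Adj v x := by
  obtain ⟨φ, h1, h2⟩ := h
  have hX : ∀ x, x ∈ U.filter (fun z => ∃ x, φ (.inl x) = z) ↔ ∃ y, φ (.inl y) = x := fun x =>
    mem_filter.trans ⟨And.right, fun ⟨y, hy⟩ => ⟨hy ▸ h1 _, y, hy⟩⟩
  have hY : ∀ x, x ∈ U.filter (fun z => ∃ x, φ (.inr (.inl x)) = z) ↔
      ∃ y, φ (.inr (.inl y)) = x := fun x =>
    mem_filter.trans ⟨And.right, fun ⟨y, hy⟩ => ⟨hy ▸ h1 _, y, hy⟩⟩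
  refine ⟨_, filter_subset _ _, _, filter_subset _ _, φ (.inr (.inr ())), h1 _,
    ⟨fun x => φ (.inl x), fun x => (hX _).2 ⟨x, rfl⟩, fun x y hxy => h2 _ _ hxy⟩,
    ⟨fun x => φ (.inr (.inl x)), fun x => (hY _).2 ⟨x, rfl⟩, fun x y hxy => h2 _ _ hxy⟩,
    ?_, ?_, ?_⟩
  · intro x hx y hy
    obtain ⟨x, rfl⟩ := (hX x).1 hx
    obtain ⟨y, rfl⟩ := (hY y).1 hy
    exact h2 _ _ trivial
  · intro y hy
    obtain ⟨y, rfl⟩ := (hY y).1 hy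
    exact h2 _ _ trivial
  · intro x hx
    obtain ⟨x, rfl⟩ := (hX x).1 hx
    exact h2 _ _ trivial

/-- The vertices `v i` and the sets `K i` with `i < m` are joined as in `mountAdj`. -/
structure IsMount {m : ℕ} (T : Tournament V) (U : Finset V) (v : Fin (m + 1) → V)
    (K : ℕ → Finset V) : Prop where
  mem : ∀ i, v i ∈ U
  subset : ∀ i < m, K i ⊆ U
  adj : ∀ i j, j < i → T.Adj (v i) (v j)
  complete : ∀ i j, i < j → j < m → T.Complete (K i) (K j)
  adj_right : ∀ i : Fin (m + 1), ∀ j < m, (i : ℕ) ≤ j → ∀ x ∈ K j, T.Adj (v i) x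
  adj_left : ∀ i : Fin (m + 1), ∀ j < m, j < (i : ℕ) → ∀ x ∈ K j, T.Adj x (v i)

lemma IsMount.contains {W : Type*} {S : Tournament W} {U : Finset V} {m : ℕ}
    {v : Fin (m + 1) → V} {K : ℕ → Finset V} (h : T.IsMount U v K)
    (hS : ∀ i < m, T.Contains (K i) S) : T.Contains U (mount m S) := by
  choose φ hφ1 hφ2 using hS
  refine ⟨Sum.elim v fun p => φ p.1 p.1.2 p.2, ?_, ?_⟩
  · rintro (i | ⟨j, x⟩)
    · exact h.mem i
    · exact h.subset j j.2 (hφ1 j j.2 x)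
  · rintro (i | ⟨i, x⟩) (j | ⟨j, y⟩) hij
    · exact h.adj i j hij
    · exact h.adj_right i j j.2 hij _ (hφ1 j j.2 y)
    · exact h.adj_left j i i.2 hij _ (hφ1 i i.2 x)
    · rcases hij with hij | ⟨rfl, hij⟩
      · exact h.complete i j hij j.2 _ (hφ1 i i.2 x) _ (hφ1 j j.2 y)
      · exact hφ2 i i.2 x y hij

lemma Contains.exists_isMount {W : Type*} {S : Tournament W} {U : Finset V} {m : ℕ}
    (h : T.Contains U (mount m S)) :
    ∃ (v : Fin (m + 1) → V) (K : ℕ → Finset V), T.IsMount U v K ∧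
      ∀ i < m, T.Contains (K i) S := by
  obtain ⟨φ, h1, h2⟩ := h
  have hK : ∀ i x, x ∈ U.filter (fun z => ∃ (hi : i < m) (y : W), φ (.inr (⟨i, hi⟩, y)) = z) ↔
      ∃ (hi : i < m) (y : W), φ (.inr (⟨i, hi⟩, y)) = x := fun i x =>
    mem_filter.trans ⟨And.right, fun ⟨hi, y, hy⟩ => ⟨hy ▸ h1 _, hi, y, hy⟩⟩
  refine ⟨fun i => φ (.inl i),
    fun i => U.filter fun z => ∃ (hi : i < m) (y : W), φ (.inr (⟨i, hi⟩, y)) = z,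
    ⟨fun i => h1 _, fun i _ => filter_subset _ _, fun i j hij => h2 _ _ hij, ?_, ?_, ?_⟩,
    fun i hi => ⟨fun x => φ (.inr (⟨i, hi⟩, x)), fun x => (hK i _).2 ⟨hi, x, rfl⟩,
      fun x y hxy => h2 _ _ (Or.inr ⟨rfl, hxy⟩)⟩⟩
  · intro i j hij _ x hx y hy
    obtain ⟨hi, x, rfl⟩ := (hK i x).1 hx
    obtain ⟨hj, y, rfl⟩ := (hK j y).1 hy
    exact h2 _ _ (Or.inl hij)
  · intro i j _ hij x hx
    obtain ⟨hj, x, rfl⟩ := (hK j x).1 hx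
    exact h2 _ _ hij
  · intro i j _ hij x hx
    obtain ⟨hj, x, rfl⟩ := (hK j x).1 hx
    exact h2 _ _ hij

/-- A large set contains a large subset all of whose vertices attach to `J` in the same way. -/
lemma exists_uniform_subset [Finite V] {J R : Finset V} {ℓ c : ℕ} (hJ : J.card ≤ ℓ)
    (hdisj : ∀ x ∈ J, x ∉ R) (hR : ¬ T.CliqueBounded R (2 ^ ℓ * c)) :
    ∃ P ⊆ J, ∃ R' ⊆ R, ¬ T.CliqueBounded R' c ∧ T.Complete P R' ∧ T.Complete R' (J \ P) := by
  by_contra hcon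
  push Not at hcon
  refine hR ((CliqueBounded.biUnion (T := T) (s := J.powerset)
    (f := fun P => R.filter fun x => J.filter (fun y => T.Adj y x) = P) (m := c) fun P hP => ?_).mono
    (fun x hx => ?_) ?_)
  · by_contra hb
    refine hcon P (mem_powerset.1 hP) _ (filter_subset _ _) hb (fun x hx y hy => ?_)
      fun x hx y hy => ?_
    · obtain ⟨-, h⟩ := mem_filter.1 hy
      rw [← h] at hx
      exact (mem_filter.1 hx).2
    · obtain ⟨hxR, h⟩ := mem_filter.1 hx
      obtain ⟨hyJ, hyP⟩ := mem_sdiff.1 hy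
      refine T.adj_of_not_adj (fun he => hdisj y hyJ (he ▸ hxR)) fun hyx => hyP ?_
      rw [← h]
      exact mem_filter.2 ⟨hyJ, hyx⟩
  · exact mem_biUnion.2 ⟨_, mem_powerset.2 (filter_subset _ _), mem_filter.2 ⟨hx, rfl⟩⟩
  · rw [card_powerset]
    exact Nat.mul_le_mul_right _ (Nat.pow_le_pow_right (by norm_num) hJ)

/-- If large subsets of `S j` are never complete to large subsets of `S i` for `i < j`, then there
are large subsets of the sets `S i` each complete to the later ones. -/
lemma exists_complete_subsets (c r : ℕ) :
    ∃ C : ℕ, c ≤ C ∧ ∀ (V : Type u) [Finite V] (T : Tournament V) (S : ℕ → Finset V),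
      (∀ i < r, ¬ T.CliqueBounded (S i) C) → (∀ i j, i < j → j < r → Disjoint (S i) (S j)) →
      (∀ i j, i < j → j < r → ∀ X ⊆ S i, ∀ Y ⊆ S j, ¬ T.CliqueBounded X c →
        ¬ T.CliqueBounded Y c → ¬ T.Complete Y X) →
      ∃ K : ℕ → Finset V, (∀ i < r, K i ⊆ S i ∧ ¬ T.CliqueBounded (K i) c) ∧
        ∀ i j, i < j → j < r → T.Complete (K i) (K j) := by
  induction r with
  | zero => exact ⟨c, le_rfl, fun V _ T S _ _ _ =>
      ⟨S, fun i hi => absurd hi (Nat.not_lt_zero _), fun i j _ hj => absurd hj (Nat.not_lt_zero _)⟩⟩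
  | succ r ih =>
    obtain ⟨C, hcC, ih⟩ := ih
    -- The small set `J ⊆ S 0` will lose `r` pieces of clique number at most `c`, one for each later
    -- set, and must stay above `c`.
    obtain ⟨ℓ, f, hlf⟩ := exists_subset_not_cliqueBounded.{u} (c + r * c)
    refine ⟨f + 2 ^ ℓ * C, hcC.trans ((Nat.le_mul_of_pos_left _ (by positivity)).trans
      (Nat.le_add_left _ _)), fun V _ T S hS hdisj hno => ?_⟩
    obtain ⟨J, hJS, hJc, hJ⟩ := hlf V T (S 0) fun h =>
      hS 0 (Nat.succ_pos _) (h.mono subset_rfl (Nat.le_add_right _ _))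
    have hP : ∀ j, ∃ P ⊆ J, ∃ R ⊆ S (j + 1), j < r →
        ¬ T.CliqueBounded R C ∧ T.Complete P R ∧ T.Complete R (J \ P) := by
      intro j
      by_cases hj : j < r
      · obtain ⟨P, hP, R, hR, h⟩ := exists_uniform_subset (T := T) hJc (R := S (j + 1)) (c := C)
          (fun x hx => disjoint_left.1 (hdisj 0 (j + 1) (Nat.succ_pos _) (by omega)) (hJS hx))
          fun h => hS (j + 1) (by omega) (h.mono subset_rfl (Nat.le_add_left _ _))
        exact ⟨P, hP, R, hR, fun _ => h⟩
      · exact ⟨∅, empty_subset _, ∅, empty_subset _, fun h => absurd h hj⟩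
    choose P hPJ R hRS hPR using hP
    obtain ⟨K, hK1, hK2⟩ := ih V T R (fun i hi => (hPR i hi).1)
      (fun i j hij hj => (hdisj (i + 1) (j + 1) (by omega) (by omega)).mono (hRS i) (hRS j))
      fun i j hij hj X hX Y hY => hno (i + 1) (j + 1) (by omega) (by omega) X (hX.trans (hRS i)) Y
        (hY.trans (hRS j))
    -- `R j` is complete to `J \ P j`, the forbidden direction, so `J \ P j` cannot be large.
    have hJP : ∀ j < r, T.CliqueBounded (J \ P j) c := by
      intro j hj
      by_contra hb
      exact hno 0 (j + 1) (Nat.succ_pos _) (by omega) _ (sdiff_subset.trans hJS) _ (hRS j) hb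
        (fun h => (hPR j hj).1 (h.mono subset_rfl hcC)) (hPR j hj).2.2
    refine ⟨fun i => if i = 0 then J.filter fun x => ∀ j < r, x ∈ P j else K (i - 1), ?_, ?_⟩
    · rintro (_ | i) hi
      · simp only [if_true]
        refine ⟨(filter_subset _ _).trans hJS, fun hb => hJ ?_⟩
        refine (hb.union (CliqueBounded.biUnion (s := range r) fun j hj =>
          hJP j (mem_range.1 hj))).mono (fun x hx => ?_) (by rw [card_range])
        rw [mem_union, mem_filter, mem_biUnion]
        by_contra hcon
        push Not at hcon
        obtain ⟨j, hj, hxj⟩ := hcon.1 hx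
        exact hcon.2 j (mem_range.2 hj) (mem_sdiff.2 ⟨hx, hxj⟩)
      · simp only [Nat.succ_ne_zero, if_false, Nat.add_sub_cancel]
        have := hK1 i (by omega)
        exact ⟨this.1.trans (hRS i), this.2⟩
    · rintro (_ | i) (_ | j) hij hj
      · exact absurd hij (lt_irrefl _)
      · simp only [Nat.succ_ne_zero, if_false, if_true, Nat.add_sub_cancel]
        intro x hx y hy
        have hjr : j < r := by omega
        exact (hPR j hjr).2.1 x ((mem_filter.1 hx).2 j hjr) y ((hK1 j hjr).1 hy)
      · exact absurd hij (Nat.not_lt_zero _)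
      · simp only [Nat.succ_ne_zero, if_false, Nat.add_sub_cancel]
        exact hK2 i j (by omega) (by omega)

/-- A set of vertices in which all sets between two vertices are bounded is bounded. -/
lemma cliqueBounded_of_between_of_exists_subset [Finite V] {U Y : Finset V} {ℓ f C : ℕ}
    (hlf : ∀ S ⊆ U, ¬ T.CliqueBounded S f → ∃ J ⊆ S, J.card ≤ ℓ ∧ ¬ T.CliqueBounded J C)
    (hYU : Y ⊆ U) (hY : ∀ u ∈ Y, ∀ v ∈ Y, ¬ T.Big U C u v) :
    T.CliqueBounded Y (1 + ((f + ℓ * (C + 1)) + (f + ℓ * (C + 1)))) := by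
  rcases Y.eq_empty_or_nonempty with rfl | ⟨v, hv⟩
  · exact (T.cliqueBounded_card ∅).mono subset_rfl (by simp)
  have hsub : ∀ p : V → Prop, Y.filter p ⊆ U := fun p => (filter_subset _ _).trans hYU
  have h1 : T.CliqueBounded (Y.filter fun y => T.Adj v y) (f + ℓ * (C + 1)) := by
    by_cases hf : T.CliqueBounded (Y.filter fun y => T.Adj v y) f
    · exact hf.mono subset_rfl (Nat.le_add_right _ _)
    obtain ⟨J, hJ, hJc, hJb⟩ := hlf _ (hsub _) hf
    refine (T.cliqueBounded_of_dominated (R := fun e y => T.Adj y e) (m := C) hJc (fun y hy => ?_)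
      fun e he => (not_not.1 (hY v hv e (mem_filter.1 (hJ he)).1)).mono (fun y hy => by
      simp only [mem_filter] at hy
      exact mem_between.2 ⟨hYU hy.1.1, hy.1.2, hy.2⟩) le_rfl).mono subset_rfl (Nat.le_add_left _ _)
    by_contra hcon
    push Not at hcon
    refine hJb ((not_not.1 (hY v hv y (mem_filter.1 hy).1)).mono (fun x hx => ?_) le_rfl)
    obtain ⟨hxY, hvx⟩ := mem_filter.1 (hJ hx)
    exact mem_between.2 ⟨hYU hxY, hvx, T.adj_of_not_adj (fun he => hcon.1 (he ▸ hx)) (hcon.2 x hx)⟩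
  have h2 : T.CliqueBounded (Y.filter fun y => T.Adj y v) (f + ℓ * (C + 1)) := by
    by_cases hf : T.CliqueBounded (Y.filter fun y => T.Adj y v) f
    · exact hf.mono subset_rfl (Nat.le_add_right _ _)
    obtain ⟨J, hJ, hJc, hJb⟩ := hlf _ (hsub _) hf
    refine (T.cliqueBounded_of_dominated (R := fun e y => T.Adj e y) (m := C) hJc (fun y hy => ?_)
      fun e he => (not_not.1 (hY e (mem_filter.1 (hJ he)).1 v hv)).mono (fun y hy => by
      simp only [mem_filter] at hy
      exact mem_between.2 ⟨hYU hy.1.1, hy.2, hy.1.2⟩) le_rfl).mono subset_rfl (Nat.le_add_left _ _)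
    by_contra hcon
    push Not at hcon
    refine hJb ((not_not.1 (hY y (mem_filter.1 hy).1 v hv)).mono (fun x hx => ?_) le_rfl)
    obtain ⟨hxY, hxv⟩ := mem_filter.1 (hJ hx)
    exact mem_between.2 ⟨hYU hxY, T.adj_of_not_adj (fun he => hcon.1 (he ▸ hx)) (hcon.2 x hx), hxv⟩
  refine (T.cliqueBounded_card {v}).cover (h1.union h2) (fun y hy => ?_) le_rfl
  simp only [mem_union, mem_singleton, mem_filter]
  by_cases hyv : y = v
  · exact Or.inl hyv
  · exact Or.inr ((T.total v y (Ne.symm hyv)).imp (fun h => ⟨hy, h⟩) fun h => ⟨hy, h⟩)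

/-- A small `J` from `u` to `v` and a large `R` from `v` to `u` attached uniformly to it satisfy `P
⇒ R ⇒ J \ P`. If `P` is large then `P ⇒ R ⇒ u ⇒ P`; otherwise `R ⇒ J \ P ⇒ v ⇒ R`. -/
lemma not_big_of_not_contains_delta [Finite V] {W : Type*} {S : Tournament W} {U : Finset V}
    {ℓ f c : ℕ}
    (hlf : ∀ S ⊆ U, ¬ T.CliqueBounded S f → ∃ J ⊆ S, J.card ≤ ℓ ∧ ¬ T.CliqueBounded J (c + c))
    (hS : ∀ X ⊆ U, ¬ T.CliqueBounded X c → T.Contains X S)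
    (hU : ¬ T.Contains U (delta S S single)) {u v : V} (hu : u ∈ U) (hv : v ∈ U)
    (huv : T.Big U (f + 2 ^ ℓ * c) u v) : ¬ T.Big U (f + 2 ^ ℓ * c) v u := by
  intro hvu
  have hbU : ∀ x y, T.between U x y ⊆ U := fun _ _ => filter_subset _ _
  obtain ⟨J, hJ, hJc, hJb⟩ := hlf _ (hbU u v) fun h =>
    huv (h.mono subset_rfl (Nat.le_add_right _ _))
  obtain ⟨P, hP, R, hR, hRb, hPR, hRP⟩ := exists_uniform_subset (T := T) hJc
    (R := T.between U v u) (c := c)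
    (fun x hx hx' => T.asymm _ _ (mem_between.1 (hJ hx)).2.1 (mem_between.1 hx').2.2)
    fun h => hvu (h.mono subset_rfl (Nat.le_add_left _ _))
  have hRU := hR.trans (hbU v u)
  have hJU := hJ.trans (hbU u v)
  by_cases hPb : T.CliqueBounded P c
  · have hQb : ¬ T.CliqueBounded (J \ P) c := fun hQb =>
      hJb (hPb.cover hQb (fun x hx => by simp [hx]) le_rfl)
    have hQU : J \ P ⊆ U := sdiff_subset.trans hJU
    exact hU (contains_delta_single hRU hQU hv (hS _ hRU hRb) (hS _ hQU hQb) hRP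
      (fun y hy => (mem_between.1 (hJ (mem_sdiff.1 hy).1)).2.2)
      fun x hx => (mem_between.1 (hR hx)).2.1)
  · have hPU := hP.trans hJU
    exact hU (contains_delta_single hPU hRU hu (hS _ hPU hPb) (hS _ hRU hRb) hPR
      (fun y hy => (mem_between.1 (hR hy)).2.2)
      fun x hx => (mem_between.1 (hJ (hP hx))).2.1)

/-- The vertices of `U` that are out-neighbours of `v 0, …, v i` and in-neighbours of the later
terms of the sequence `v`. -/
noncomputable def slot {m : ℕ} (T : Tournament V) (U : Finset V) (v : Fin (m + 1) → V) (i : ℕ) :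
    Finset V :=
  U.filter fun x => ∀ j : Fin (m + 1), ((j : ℕ) ≤ i → T.Adj (v j) x) ∧ (i < j → T.Adj x (v j))

/-- A vertex from `v i` to `v (i + 1)` that misses the slot goes from `v i` to an earlier term or
from a later term to `v (i + 1)`. Those sets run against the big direction, so they are bounded. -/
lemma not_cliqueBounded_slot [Finite V] {m C C' : ℕ} {U : Finset V} {v : Fin (m + 1) → V}
    (hv : ∀ i j, i < j → T.Adj (v j) (v i)) (hb : ∀ i j, i < j → ¬ T.Big U C (v j) (v i))
    {i : Fin m} (hi : T.Big U (C' + (m + 1) * C) (v i.castSucc) (v i.succ)) :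
    ¬ T.CliqueBounded (T.slot U v i) C' := by
  intro hs
  have hE : ∀ j ∈ (univ : Finset (Fin (m + 1))), T.CliqueBounded
      (if j < i.castSucc then T.between U (v i.castSucc) (v j) else
        if i.succ < j then T.between U (v j) (v i.succ) else ∅) C := by
    intro j _
    split_ifs with h1 h2
    · exact not_not.1 (hb _ _ h1)
    · exact not_not.1 (hb _ _ h2)
    · exact (T.cliqueBounded_card ∅).mono subset_rfl (by simp)
  refine hi (hs.cover (CliqueBounded.biUnion hE) (fun x hx => ?_) (by simp))
  obtain ⟨hxU, h1, h2⟩ := mem_between.1 hx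
  rw [mem_union, mem_biUnion]
  by_contra hcon
  push Not at hcon
  refine hcon.1 (mem_filter.2 ⟨hxU, fun j => ⟨fun hj => ?_, fun hj => ?_⟩⟩)
  · rcases eq_or_lt_of_le (show j ≤ i.castSucc from hj) with rfl | hj'
    · exact h1
    refine T.adj_of_not_adj ?_ fun hxj => hcon.2 j (mem_univ _) ?_
    · rintro rfl
      exact T.asymm _ _ h2 (hv _ _ (hj'.trans Fin.castSucc_lt_succ))
    · rw [if_pos hj']
      exact mem_between.2 ⟨hxU, h1, hxj⟩
  · rcases eq_or_lt_of_le (show i.succ ≤ j from hj) with rfl | hj'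
    · exact h2
    refine T.adj_of_not_adj ?_ fun hxj => hcon.2 j (mem_univ _) ?_
    · rintro rfl
      exact T.asymm _ _ h1 (hv _ _ (Fin.castSucc_lt_succ.trans hj'))
    · rw [if_neg (Fin.castSucc_lt_succ.trans hj').asymm, if_pos hj']
      exact mem_between.2 ⟨hxU, hxj, h2⟩

/-- Every set of large clique number contains a copy of `A m` or of `D n`. -/
theorem exists_contains (m n : ℕ) :
    ∃ c : ℕ, ∀ (V : Type u) [Finite V] (T : Tournament V) (U : Finset V),
      ¬ T.CliqueBounded U c → T.Contains U (A m) ∨ T.Contains U (D n) := by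
  induction m generalizing n with
  | zero => exact ⟨0, fun V _ T U _ => Or.inl (contains_empty U)⟩
  | succ m ihm =>
    induction n with
    | zero => exact ⟨0, fun V _ T U _ => Or.inr (contains_empty U)⟩
    | succ n ihn =>
      obtain ⟨c₁, ihm⟩ := ihm (n + 1)
      obtain ⟨c₂, ihn⟩ := ihn
      -- Above `c`, a set inside `U` contains both `A m` and `D n`, since the alternatives `D (n +
      -- 1)` and `A (m + 1)` are excluded.
      set c := c₁ + c₂ with hc
      obtain ⟨Cs, hcs, hslots⟩ := exists_complete_subsets.{u} c m
      obtain ⟨ℓ, f, hlf⟩ := exists_subset_not_cliqueBounded.{u} (c + c)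
      set C := f + 2 ^ ℓ * c with hC
      set C' := Cs + (m + 1) * C with hC'
      obtain ⟨ℓ', f', hlf'⟩ := exists_subset_not_cliqueBounded.{u} (2 * C' + 3 * C + 4)
      refine ⟨3 * (1 + ((f' + ℓ' * (2 * C' + 3 * C + 4 + 1)) +
        (f' + ℓ' * (2 * C' + 3 * C + 4 + 1)))) * m, fun V _ T U hU => ?_⟩
      by_contra hcon
      push Not at hcon
      obtain ⟨hnoA, hnoD⟩ := hcon
      have hA : ∀ X ⊆ U, ¬ T.CliqueBounded X c → T.Contains X (A m) := fun X hX hb =>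
        (ihm V T X fun h => hb (h.mono subset_rfl (by omega))).resolve_right
          fun h => hnoD (h.mono hX)
      have hD : ∀ X ⊆ U, ¬ T.CliqueBounded X c → T.Contains X (D n) := fun X hX hb =>
        (ihn V T X fun h => hb (h.mono subset_rfl (by omega))).resolve_left
          fun h => hnoA (h.mono hX)
      have ha : ∀ u ∈ U, ∀ v ∈ U, T.Big U C u v → ¬ T.Big U C v u := fun u hu v hv =>
        not_big_of_not_contains_delta (fun S _ => hlf V T S) hD hnoD hu hv
      refine hU (T.cliqueBounded_of_zones (C := C) (C' := C')
        (le_add_left (Nat.le_mul_of_pos_left _ (Nat.succ_pos _))) ha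
        (fun Y hY hb => cliqueBounded_of_between_of_exists_subset (fun S _ => hlf' V T S) hY hb)
        fun l hlU hl => ?_)
      by_contra hlen
      rw [List.pairwise_iff_getElem] at hl
      have hlt : ∀ i : Fin (m + 1), (i : ℕ) < l.length := fun i => by omega
      set v : Fin (m + 1) → V := fun i => l[(i : ℕ)]'(hlt i) with hvdef
      have hv : ∀ i, v i ∈ U := fun i => hlU _ (List.getElem_mem _)
      have hvv : ∀ i j, i < j → T.Adj (v j) (v i) ∧ T.Big U C' (v i) (v j) :=
        fun i j hij => hl i j (hlt i) (hlt j) hij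
      have hCC : C ≤ C' := le_add_left (Nat.le_mul_of_pos_left _ (Nat.succ_pos _))
      have hslotU : ∀ i, T.slot U v i ⊆ U := fun i => filter_subset _ _
      obtain ⟨K, hK1, hK2⟩ := hslots V T (T.slot U v)
        (fun i hi => not_cliqueBounded_slot (fun i j hij => (hvv i j hij).1)
          (fun i j hij => ha _ (hv i) _ (hv j) ((hvv i j hij).2.mono hCC)) (i := ⟨i, hi⟩)
          (hvv _ _ Fin.castSucc_lt_succ).2)
        (fun i j hij hj => disjoint_left.2 fun x hx hx' => T.asymm _ _
          (((mem_filter.1 hx).2 ⟨j, by omega⟩).2 hij)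
          (((mem_filter.1 hx').2 ⟨j, by omega⟩).1 le_rfl))
        -- With `i < j`, slot `i` points to `v j` and `v j` to slot `j`; `Y ⇒ X` would close the
        -- cycle `Y ⇒ X ⇒ v j ⇒ Y` and give `D (n + 1)`.
        (fun i j hij hj X hX Y hY hXb hYb hYX => hnoD
          (contains_delta_single (v := v ⟨j, by omega⟩) (hY.trans (hslotU j))
            (hX.trans (hslotU i)) (hv _)
            (hD _ (hY.trans (hslotU j)) hYb) (hD _ (hX.trans (hslotU i)) hXb) hYX
            (fun x hx => ((mem_filter.1 (hX hx)).2 ⟨j, by omega⟩).2 hij)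
            fun x hx => ((mem_filter.1 (hY hx)).2 ⟨j, by omega⟩).1 le_rfl))
      have hmount : T.IsMount U v K := ⟨hv, fun i hi => (hK1 i hi).1.trans (hslotU i),
        fun i j hij => (hvv j i hij).1, hK2,
        fun i j hj hij x hx => ((mem_filter.1 ((hK1 j hj).1 hx)).2 i).1 hij,
        fun i j hj hij x hx => ((mem_filter.1 ((hK1 j hj).1 hx)).2 i).2 hij⟩
      exact hnoA (hmount.contains fun i hi =>
        hA _ ((hK1 i hi).1.trans (hslotU i)) (hK1 i hi).2)

end Containment
end Tournament

/-! ### Ramsey properties and unbounded clique number of `A n` and `D n`. -/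

namespace Tournament
section LowerBounds
open Finset
open scoped Classical
universe u
variable {V : Type u} {T : Tournament V}

/-- Among chosen vertices, the copy just after each one except the last precedes the next chosen
vertex, so these copies sit in the right gaps. -/
lemma IsMount.select {m a : ℕ} {U X : Finset V} {v : Fin (m + 1) → V} {K : ℕ → Finset V}
    (h : T.IsMount U v K) (e : Fin (a + 1) ↪o Fin (m + 1)) (hX : ∀ i, v (e i) ∈ X) :
    T.IsMount X (v ∘ e)
      (fun i => if hi : i < a then K (e ⟨i, Nat.lt_succ_of_lt hi⟩) ∩ X else ∅) := by
  have hlt : ∀ i (hi : i < a), (e ⟨i, Nat.lt_succ_of_lt hi⟩ : ℕ) < m := by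
    intro i hi
    have h1 : e ⟨i, Nat.lt_succ_of_lt hi⟩ < e ⟨i + 1, Nat.succ_lt_succ hi⟩ :=
      e.lt_iff_lt.2 (Nat.lt_succ_self i)
    have h2 := (e ⟨i + 1, Nat.succ_lt_succ hi⟩).2
    have h3 : (e ⟨i, Nat.lt_succ_of_lt hi⟩ : ℕ) < e ⟨i + 1, Nat.succ_lt_succ hi⟩ := h1
    omega
  refine ⟨hX, fun i hi => ?_, fun i j hij => h.adj _ _ (e.lt_iff_lt.2 hij),
    fun i j hij hj => ?_, fun i j hj hij x hx => ?_, fun i j hj hij x hx => ?_⟩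
  · rw [dif_pos hi]
    exact inter_subset_right
  · rw [dif_pos (hij.trans hj), dif_pos hj]
    intro x hx y hy
    exact h.complete _ _ (e.lt_iff_lt.2 hij) (hlt j hj) x (mem_inter.1 hx).1 y (mem_inter.1 hy).1
  · rw [dif_pos hj] at hx
    exact h.adj_right _ _ (hlt j hj) (e.le_iff_le.2 hij) x (mem_inter.1 hx).1
  · rw [dif_pos hj] at hx
    exact h.adj_left _ _ (hlt j hj) (e.lt_iff_lt.2 hij) x (mem_inter.1 hx).1

lemma inter_cover {α : Type*} {K U X Y : Finset α} (hK : K ⊆ U) (hU : U ⊆ X ∪ Y) :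
    K ⊆ K ∩ X ∪ K ∩ Y := by
  rw [← inter_union_distrib_left]
  exact subset_inter subset_rfl (hK.trans hU)

/-- Ramsey property of the tournaments `A n` for colourings of the vertices. -/
lemma Contains.A_or_A {a b : ℕ} {U X Y : Finset V} (h : T.Contains U (A (a + b)))
    (hU : U ⊆ X ∪ Y) : T.Contains X (A a) ∨ T.Contains Y (A b) := by
  induction a generalizing b U X Y with
  | zero => exact Or.inl (contains_empty X)
  | succ a iha =>
    induction b generalizing U X Y with
    | zero => exact Or.inr (contains_empty Y)
    | succ b ihb =>
      by_contra hcon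
      push Not at hcon
      obtain ⟨v, K, hm, hK⟩ : ∃ (v : Fin (a + 1 + b + 1) → V) (K : ℕ → Finset V),
        T.IsMount U v K ∧ ∀ i < a + 1 + b, T.Contains (K i) (A (a + 1 + b)) := h.exists_isMount
      -- Every copy keeps both `A a` in `X` and `A b` in `Y`, so only the colours of the vertices `v
      -- i` matter: `a + 1` of them in `X` or `b + 1` in `Y`.
      have hKX : ∀ i < a + 1 + b, T.Contains (K i ∩ X) (A a) := by
        intro i hi
        have h1 := hK i hi
        rw [add_right_comm, add_assoc] at h1
        exact (iha h1 (inter_cover (hm.subset i hi) hU)).resolve_right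
          fun h => hcon.2 (h.mono inter_subset_right)
      have hKY : ∀ i < a + 1 + b, T.Contains (K i ∩ Y) (A b) := fun i hi =>
        (ihb (hK i hi) (inter_cover (hm.subset i hi) hU)).resolve_left
          fun h => hcon.1 (h.mono inter_subset_right)
      have hsel : ∀ (c : ℕ) (Z : Finset V), c < (univ.filter fun i => v i ∈ Z).card →
          (∀ i < a + 1 + b, T.Contains (K i ∩ Z) (A c)) → T.Contains Z (A (c + 1)) := by
        intro c Z hc hKZ
        have hmz := hm.select (orderEmbOfCardLe _ hc) fun i =>
          (mem_filter.1 (orderEmbOfCardLe_mem _ hc i)).2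
        refine hmz.contains fun i hi => ?_
        rw [dif_pos hi]
        refine hKZ _ ?_
        have h1 : orderEmbOfCardLe _ hc ⟨i, Nat.lt_succ_of_lt hi⟩ <
            orderEmbOfCardLe _ hc ⟨i + 1, Nat.succ_lt_succ hi⟩ :=
          (orderEmbOfCardLe _ hc).lt_iff_lt.2 (Nat.lt_succ_self i)
        have h2 := (orderEmbOfCardLe _ hc ⟨i + 1, Nat.succ_lt_succ hi⟩).2
        have h3 : (orderEmbOfCardLe _ hc ⟨i, Nat.lt_succ_of_lt hi⟩ : ℕ) <
          orderEmbOfCardLe _ hc ⟨i + 1, Nat.succ_lt_succ hi⟩ := h1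
        omega
      have hcard : a + 1 + b + 1 ≤ (univ.filter fun i => v i ∈ X).card +
          (univ.filter fun i => v i ∈ Y).card := by
        refine le_trans (le_of_eq ?_) (card_union_le _ _)
        rw [← filter_or, filter_true_of_mem fun i _ => mem_union.1 (hU (hm.mem i)), card_univ,
          Fintype.card_fin]
      have h1 : ¬ a < (univ.filter fun i => v i ∈ X).card := fun h => hcon.1 (hsel a X h hKX)
      have h2 : ¬ b < (univ.filter fun i => v i ∈ Y).card := fun h => hcon.2 (hsel b Y h hKY)
      omega

/-- Ramsey property of the tournaments `D n` for colourings of the vertices. -/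
lemma Contains.D_or_D {a b : ℕ} {U X Y : Finset V} (h : T.Contains U (D (a + b)))
    (hU : U ⊆ X ∪ Y) : T.Contains X (D a) ∨ T.Contains Y (D b) := by
  induction a generalizing b U X Y with
  | zero => exact Or.inl (contains_empty X)
  | succ a iha =>
    induction b generalizing U X Y with
    | zero => exact Or.inr (contains_empty Y)
    | succ b ihb =>
      by_contra hcon
      push Not at hcon
      obtain ⟨P, hP, Q, hQ, v, hv, hPD, hQD, hPQ, hQv, hvP⟩ : ∃ P ⊆ U, ∃ Q ⊆ U, ∃ v ∈ U,
        T.Contains P (D (a + 1 + b)) ∧ T.Contains Q (D (a + 1 + b)) ∧ T.Complete P Q ∧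
          (∀ y ∈ Q, T.Adj y v) ∧ ∀ x ∈ P, T.Adj v x := h.exists_delta_single
      have hX : ∀ R ⊆ U, T.Contains R (D (a + 1 + b)) → T.Contains (R ∩ X) (D a) := by
        intro R hR h1
        rw [add_right_comm, add_assoc] at h1
        exact (iha h1 (inter_cover hR hU)).resolve_right
          fun h => hcon.2 (h.mono inter_subset_right)
      have hY : ∀ R ⊆ U, T.Contains R (D (a + 1 + b)) → T.Contains (R ∩ Y) (D b) := fun R hR h1 =>
        (ihb h1 (inter_cover hR hU)).resolve_left
          fun h => hcon.1 (h.mono inter_subset_right)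
      have hsel : ∀ (c : ℕ) (Z : Finset V), v ∈ Z → T.Contains (P ∩ Z) (D c) →
          T.Contains (Q ∩ Z) (D c) → T.Contains Z (D (c + 1)) := fun c Z hvZ h1 h2 =>
        contains_delta_single inter_subset_right inter_subset_right hvZ h1 h2
          (fun x hx y hy => hPQ x (mem_inter.1 hx).1 y (mem_inter.1 hy).1)
          (fun y hy => hQv y (mem_inter.1 hy).1) fun x hx => hvP x (mem_inter.1 hx).1
      rcases mem_union.1 (hU hv) with hvX | hvY
      · exact hcon.1 (hsel a X hvX (hX P hP hPD) (hX Q hQ hQD))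
      · exact hcon.2 (hsel b Y hvY (hY P hP hPD) (hY Q hQ hQD))

/-- Take the second colour class empty; `b + 1` ensures that `A (b + 1)` has a vertex and cannot lie
there. -/
lemma Contains.A_of_add {a b : ℕ} {U : Finset V} (h : T.Contains U (A (a + (b + 1)))) :
    T.Contains U (A a) :=
  (h.A_or_A (X := U) (Y := ∅) (by simp)).resolve_right fun ⟨_, hφ, _⟩ =>
    absurd (hφ (Sum.inl 0)) (notMem_empty _)

lemma Contains.D_of_add {a b : ℕ} {U : Finset V} (h : T.Contains U (D (a + (b + 1)))) :
    T.Contains U (D a) :=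
  (h.D_or_D (X := U) (Y := ∅) (by simp)).resolve_right fun ⟨_, hφ, _⟩ =>
    absurd (hφ (Sum.inr (Sum.inr ()))) (notMem_empty _)

/-- A vertex adjacent in the backedge graph to all vertices of a set extends its cliques. -/
lemma exists_backClique_succ {r : V → ℕ} {U W : Finset V} {k : ℕ} {e : V} (he : e ∈ U)
    (hW : W ⊆ U) (h : ∃ Q ⊆ W, T.BackClique r Q ∧ k ≤ Q.card)
    (hadj : ∀ y ∈ W, T.BackAdj r y e) : ∃ Q ⊆ U, T.BackClique r Q ∧ k + 1 ≤ Q.card := by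
  obtain ⟨Q, hQ, hc, hk⟩ := h
  refine ⟨insert e Q, insert_subset he (hQ.trans hW), hc.insert fun y hy =>
    ⟨fun hlt => ?_, fun hlt => ?_⟩, ?_⟩
  · rcases hadj y (hQ hy) with h' | h'
    · exact h'.2
    · exact absurd h'.1 hlt.asymm
  · rcases hadj y (hQ hy) with h' | h'
    · exact absurd h'.1 hlt.asymm
    · exact h'.2
  · rw [card_insert_of_notMem]
    · exact Nat.succ_le_succ hk
    · intro hm
      rcases hadj e (hQ hm) with h' | h' <;> exact absurd h'.1 (lt_irrefl _)

/-- The tournaments `A n` have unbounded clique number. -/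
theorem exists_backClique_of_contains_A (k : ℕ) :
    ∃ n, k ≤ n ∧ ∀ (V : Type u) (T : Tournament V) (r : V → ℕ), Function.Injective r →
      ∀ U : Finset V, T.Contains U (A n) → ∃ Q ⊆ U, T.BackClique r Q ∧ k ≤ Q.card := by
  induction k with
  | zero => exact ⟨0, le_rfl, fun V T r _ U _ =>
      ⟨∅, empty_subset _, fun x hx => absurd hx (notMem_empty x), Nat.zero_le _⟩⟩
  | succ k ih =>
    obtain ⟨n, hkn, ih⟩ := ih
    refine ⟨n + n + 1, by omega, fun V T r hr U hU => ?_⟩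
    obtain ⟨v, K, hm, hK⟩ : ∃ (v : Fin (n + n + 1) → V) (K : ℕ → Finset V),
      T.IsMount U v K ∧ ∀ i < n + n, T.Contains (K i) (A (n + n)) := hU.exists_isMount
    -- If the `v i` are ranked in index order, they form a clique. Otherwise some `v (i + 1)`
    -- precedes `v i`, so every vertex of `K i` is before `v i` or after `v (i + 1)`; either way it
    -- is joined by a backedge.
    by_cases hmono : StrictMono (r ∘ v)
    · refine ⟨univ.image v, fun x hx => ?_, fun x hx y hy hxy => ?_, ?_⟩
      · obtain ⟨i, -, rfl⟩ := mem_image.1 hx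
        exact hm.mem i
      · obtain ⟨i, -, rfl⟩ := mem_image.1 hx
        obtain ⟨j, -, rfl⟩ := mem_image.1 hy
        exact hm.adj _ _ (hmono.lt_iff_lt.1 hxy)
      · rw [card_image_of_injective _ hmono.injective.of_comp, card_univ, Fintype.card_fin]
        omega
    · rw [Fin.strictMono_iff_lt_succ] at hmono
      push Not at hmono
      obtain ⟨i, hi⟩ := hmono
      have hadj := hm.adj i.succ i.castSucc Fin.castSucc_lt_succ
      have hlt : r (v i.succ) < r (v i.castSucc) :=
        lt_of_le_of_ne hi fun he => T.ne_of_adj hadj (hr he)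
      rcases (hK i i.2).A_or_A (X := (K i).filter fun x => r x < r (v i.castSucc))
        (Y := (K i).filter fun x => r (v i.succ) < r x) (fun x hx => by
          rw [mem_union, mem_filter, mem_filter]
          rcases lt_or_ge (r x) (r (v i.castSucc)) with h | h
          · exact Or.inl ⟨hx, h⟩
          · exact Or.inr ⟨hx, hlt.trans_le h⟩) with h | h
      · exact exists_backClique_succ (hm.mem i.castSucc)
          ((filter_subset _ _).trans (hm.subset i i.2)) (ih V T r hr _ h) fun y hy =>
          Or.inl ⟨(mem_filter.1 hy).2, hm.adj_right _ i i.2 le_rfl y (mem_filter.1 hy).1⟩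
      · exact exists_backClique_succ (hm.mem i.succ)
          ((filter_subset _ _).trans (hm.subset i i.2)) (ih V T r hr _ h) fun y hy =>
          Or.inr ⟨(mem_filter.1 hy).2, hm.adj_left _ i i.2 (Nat.lt_succ_self _) y
            (mem_filter.1 hy).1⟩

/-- The tournaments `D n` have unbounded clique number. -/
theorem exists_backClique_of_contains_D (k : ℕ) :
    ∃ n, ∀ (V : Type u) (T : Tournament V) (r : V → ℕ), Function.Injective r →
      ∀ U : Finset V, T.Contains U (D n) → ∃ Q ⊆ U, T.BackClique r Q ∧ k ≤ Q.card := by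
  induction k with
  | zero => exact ⟨0, fun V T r _ U _ =>
      ⟨∅, empty_subset _, fun x hx => absurd hx (notMem_empty x), Nat.zero_le _⟩⟩
  | succ k ih =>
    obtain ⟨n, ih⟩ := ih
    refine ⟨n + n + 1, fun V T r hr U hU => ?_⟩
    obtain ⟨P, hP, Q, hQ, v, hv, hPD, hQD, hPQ, hQv, hvP⟩ : ∃ P ⊆ U, ∃ Q ⊆ U, ∃ v ∈ U,
      T.Contains P (D (n + n)) ∧ T.Contains Q (D (n + n)) ∧ T.Complete P Q ∧
        (∀ y ∈ Q, T.Adj y v) ∧ ∀ x ∈ P, T.Adj v x := hU.exists_delta_single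
    have hcov : ∀ R : Finset V, (∀ x ∈ R, x ≠ v) →
        R ⊆ (R.filter fun x => r x < r v) ∪ (R.filter fun x => r v < r x) := by
      intro R hR x hx
      rw [mem_union, mem_filter, mem_filter]
      exact (lt_or_gt_of_ne fun he => hR x hx (hr he)).imp (fun h => ⟨hx, h⟩) fun h => ⟨hx, h⟩
    rcases hPD.D_or_D (hcov P fun x hx => (T.ne_of_adj (hvP x hx)).symm) with h | h
    · exact exists_backClique_succ hv ((filter_subset _ _).trans hP) (ih V T r hr _ h)
        fun y hy => Or.inl ⟨(mem_filter.1 hy).2, hvP y (mem_filter.1 hy).1⟩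
    -- Now a copy in `P` lies after `v`. If a copy in `Q` lies before `v`, then `P ⇒ Q` joins the
    -- two cliques into one of size at least `2 * k`; this exceeds `k` unless `k = 0`.
    rcases hQD.D_or_D (hcov Q fun x hx => T.ne_of_adj (hQv x hx)) with h' | h'
    · obtain ⟨Q₁, hQ₁, hc₁, hk₁⟩ := ih V T r hr _ h
      obtain ⟨Q₂, hQ₂, hc₂, hk₂⟩ := ih V T r hr _ h'
      have h1 := fun (x : V) (hx : x ∈ Q₁) => mem_filter.1 (hQ₁ hx)
      have h2 := fun (x : V) (hx : x ∈ Q₂) => mem_filter.1 (hQ₂ hx)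
      rcases Nat.eq_zero_or_pos k with rfl | hk
      · exact ⟨{v}, by simpa using hv, backClique_singleton _ _, by simp⟩
      refine ⟨Q₁ ∪ Q₂, union_subset (hQ₁.trans ((filter_subset _ _).trans hP))
        (hQ₂.trans ((filter_subset _ _).trans hQ)), fun x hx y hy hxy => ?_, ?_⟩
      · rcases mem_union.1 hx with hx | hx <;> rcases mem_union.1 hy with hy | hy
        · exact hc₁ x hx y hy hxy
        · have := (h1 x hx).2
          have := (h2 y hy).2
          omega
        · exact hPQ y (h1 y hy).1 x (h2 x hx).1
        · exact hc₂ x hx y hy hxy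
      · rw [card_union_of_disjoint (disjoint_left.2 fun x hx hx' =>
          (h1 x hx).2.asymm (h2 x hx').2)]
        omega
    · exact exists_backClique_succ hv ((filter_subset _ _).trans hQ) (ih V T r hr _ h')
        fun y hy => Or.inr ⟨(mem_filter.1 hy).2, hQv y (mem_filter.1 hy).1⟩

end LowerBounds
end Tournament

/-! ### Passing between rank functions and linear orders, copies and isomorphisms. -/

namespace Tournament
section CliqueNumber
open Finset
universe u
variable {V : Type u} {T : Tournament V}

lemma CliqueBounded.cliqueNumber_le [Fintype V] {m : ℕ} (h : T.CliqueBounded univ m) :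
    T.cliqueNumber ≤ m := by
  obtain ⟨r, hr, h⟩ := h
  let L : LinearOrder V := LinearOrder.lift' r hr
  have hle : T.cliqueNumber ≤ (T.backedgeGraph L).cliqueNum := Nat.sInf_le ⟨L, rfl⟩
  refine hle.trans ?_
  obtain ⟨Q, hQ⟩ := (T.backedgeGraph L).exists_isNClique_cliqueNum
  rw [← hQ.card_eq]
  refine h Q (subset_univ Q) fun x hx y hy hxy => ?_
  rcases hQ.isClique hx hy (fun he => hxy.ne (he ▸ rfl)) with h' | h'
  · exact h'.2
  · exact absurd (show r y < r x from h'.1) hxy.asymm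

lemma le_cliqueNumber [Fintype V] {k : ℕ}
    (h : ∀ r : V → ℕ, Function.Injective r → ∃ Q, T.BackClique r Q ∧ k ≤ Q.card) :
    k ≤ T.cliqueNumber := by
  classical
  obtain ⟨s, hs⟩ := exists_injective_rank V
  -- The set of clique numbers is nonempty, so the infimum is attained; counting predecessors turns
  -- an optimal order into a rank function.
  obtain ⟨L, hL⟩ := Nat.sInf_mem (s := {m : ℕ | ∃ L : LinearOrder V,
    (T.backedgeGraph L).cliqueNum = m}) ⟨_, LinearOrder.lift' s hs, rfl⟩
  rw [cliqueNumber, ← hL]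
  have hlt : ∀ x y : V, L.lt x y → (univ.filter fun z => L.lt z x).card <
      (univ.filter fun z => L.lt z y).card := by
    refine fun x y hxy => card_lt_card ((ssubset_iff_of_subset fun z hz => ?_).2 ⟨x, ?_, ?_⟩)
    · exact mem_filter.2 ⟨mem_univ _, @lt_trans V _ _ _ _ (mem_filter.1 hz).2 hxy⟩
    · exact mem_filter.2 ⟨mem_univ _, hxy⟩
    · exact fun hx => @lt_irrefl V _ x (mem_filter.1 hx).2
  obtain ⟨Q, hQ, hk⟩ := h (fun x => (univ.filter fun z => L.lt z x).card) fun x y hxy => by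
    rcases @lt_trichotomy V L x y with h | h | h
    · exact absurd hxy (hlt x y h).ne
    · exact h
    · exact absurd hxy (hlt y x h).ne'
  refine hk.trans (SimpleGraph.IsClique.card_le_cliqueNum (tc := fun x hx y hy hne => ?_))
  rcases @lt_or_gt_of_ne V L x y hne with h | h
  · exact Or.inl ⟨h, hQ x hx y hy (hlt x y h)⟩
  · exact Or.inr ⟨h, hQ y hy x hx (hlt y x h)⟩

/-- A copy of `S` in a tournament induces a subtournament isomorphic to `S`. -/
lemma Contains.exists_isIsomorphic {W : Type*} {S : Tournament W} {U : Finset V}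
    (h : T.Contains U S) :
    ∃ X ⊆ U, X.card = Nat.card W ∧ (T.induce (X : Set V)).IsIsomorphic S := by
  classical
  obtain ⟨φ, hφ1, hφ2⟩ := h
  have hinj : Function.Injective φ := by
    intro x y hxy
    by_contra hne
    rcases S.total x y hne with h | h
    · exact T.ne_of_adj (hφ2 _ _ h) hxy
    · exact T.ne_of_adj (hφ2 _ _ h) hxy.symm
  have hX : ((U.filter fun z => z ∈ Set.range φ : Finset V) : Set V) = Set.range φ := by
    ext z
    rw [mem_coe, mem_filter]
    exact ⟨And.right, fun ⟨x, hx⟩ => ⟨hx ▸ hφ1 x, x, hx⟩⟩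
  refine ⟨U.filter fun z => z ∈ Set.range φ, filter_subset _ _, ?_, ⟨?_⟩⟩
  · rw [← Nat.card_range_of_injective hinj, ← Set.ncard_coe_finset, hX]
    rfl
  · refine RelIso.symm ⟨(Equiv.ofInjective φ hinj).trans (Equiv.setCongr hX.symm), ?_⟩
    intro x y
    refine ⟨fun h => ?_, hφ2 x y⟩
    by_contra hxy
    exact T.asymm _ _ h (hφ2 _ _ (S.adj_of_not_adj (fun he => T.ne_of_adj h (he ▸ rfl)) hxy))

lemma IsIsomorphic.contains [Fintype V] {W : Type*} {S : Tournament W} (h : T.IsIsomorphic S) :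
    T.Contains univ S := by
  obtain ⟨e⟩ := h
  exact ⟨e.symm, fun _ => mem_univ _, fun x y hxy => e.symm.map_rel_iff.2 hxy⟩

end CliqueNumber
end Tournament

/-! ### Choice of constants and assembly. -/

theorem mainTheorem4 :
    ∃ f ℓ n : ℤ → ℕ, ∀ k : ℤ, 1 ≤ n k ∧
      ∀ (V : Type*) [Finite V] (T : Tournament V), f k ≤ T.cliqueNumber →
        ∃ X : Finset V, X.card ≤ ℓ k ∧
          k ≤ ((T.induce (X : Set V)).cliqueNumber : ℤ) ∧
          ((T.induce (X : Set V)).IsIsomorphic (Tournament.A (n k)) ∨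
            (T.induce (X : Set V)).IsIsomorphic (Tournament.D (n k))) := by
  choose a _ hA using Tournament.exists_backClique_of_contains_A
  choose d hD using Tournament.exists_backClique_of_contains_D
  -- One index serving both families; the summand `1` gives `1 ≤ n k` and allows either summand to
  -- be discarded. A negative `k` is treated as `0` by `toNat`.
  let n : ℤ → ℕ := fun k => a k.toNat + (d k.toNat + 1)
  choose c hc using fun k => Tournament.exists_contains (n k) (n k)
  refine ⟨fun k => c k + 1, fun k =>
    Nat.card (Tournament.AVert (n k)) + Nat.card (Tournament.DVert (n k)), n,
    fun k => ⟨(Nat.succ_pos _).trans_le (Nat.le_add_left _ _), fun V _ T hT => ?_⟩⟩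
  have := Fintype.ofFinite V
  rcases hc k V T Finset.univ fun h => absurd hT (Nat.not_le.2 (Nat.lt_succ_of_le h.cliqueNumber_le))
    with h | h
  · obtain ⟨X, -, hX, hiso⟩ := h.exists_isIsomorphic
    refine ⟨X, hX.le.trans (Nat.le_add_right _ _), Int.toNat_le.1
      (Tournament.le_cliqueNumber fun r hr => ?_), Or.inl hiso⟩
    obtain ⟨Q, -, hQ⟩ := hA k.toNat _ _ r hr Finset.univ hiso.contains.A_of_add
    exact ⟨Q, hQ⟩
  · obtain ⟨X, -, hX, hiso⟩ := h.exists_isIsomorphic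
    refine ⟨X, hX.le.trans (Nat.le_add_left _ _), Int.toNat_le.1
      (Tournament.le_cliqueNumber fun r hr => ?_), Or.inr hiso⟩
    have h' := hiso.contains
    rw [show n k = d k.toNat + (a k.toNat + 1) by simp only [n]; omega] at h'
    obtain ⟨Q, -, hQ⟩ := hD k.toNat _ _ r hr Finset.univ h'.D_of_add
    exact ⟨Q, hQ⟩
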